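/- \textbf{Objects and traces.} A sequential object is a tuple $(Q,q_0,O,R,\sigma)$ with states $Q$, initial state $q_0$, operations $O$, responses $R$ and a transition function $\sigma:O\times Q\to R\times Q$. Operations $a,b$ \emph{commute in} $q$ if executing $a$ then $b$ from $q$ yields the same responses and the same final state as executing $b$ then $a$; they \emph{conflict}, $a\asymp b$, if they do not commute in some state. Two schedules (finite sequences of operations) are equivalent if they have the same multiset of operations and the same relative order of every two conflicting occurrences; equivalence classes are \emph{traces}. They form a monoid under concatenation, ordered by $x\le y\iff\exists z,\ y=x\cdot z$; $\sqcap$ and $\sqcup$ denote greatest lower and least upper bounds, and a set of traces is \emph{compatible} if it has an upper bound. Below, traces are traces of \emph{commands} $(op,i,seq)$ ($op\in O$, $i$ a process, $seq\in\mathbb N$), a command acting on the object exactly as $op$. \textbf{Algorithm (weakly conflict-free universal construction).} There are $n$ asynchronous processes, an array $S[1..n]$ of atomic registers, initially $(0,\epsilon)$, and generalized commit-adopt (GCA) objects $\mathrm{GCA}_1,\mathrm{GCA}_2,\dots$. To execute an operation $op$, process $i$ increments its sequence number $seq$, sets $cmd=(op,i,seq)$, $c=\mathrm{False}$, reads $S[1],\dots,S[n]$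 one after the other, and lets $(r,s)$ be the pair read with the largest round $r$. While $cmd\notin s$ or $c=\mathrm{False}$: it sets $r\leftarrow r+1$, appends $cmd$ to $s$ if it is absent, and sets $(s,c)\leftarrow\mathrm{GCA}_r.\mathrm{propose}(s)$. Finally it writes $(r,s)$ to $S[i]$ and returns the response of $cmd$ in $s$. Each $\mathrm{GCA}_r$ consists of two atomic snapshot objects $A,B$ with $n$ entries, initially $\bot$. In $\mathrm{propose}(s)$, process $i$ writes $s$ to $A[i]$; takes a snapshot $(a_1,\dots,a_n)$ of $A$; puts $a_k^{co}=\sqcap(\{a_k\}\cup\{a_j: a_j,a_k\text{ incompatible}\})$ if $a_k\ne\bot$ and $a_k^{co}=\bot$ otherwise; writes $(b_i,c_i)=(\bigsqcup_{a_k\neq\bot} a_k^{co},\ [a_k=a_k^{co}\ \forall k])$ to $B[i]$; takes a snapshot of $B$ with entries $\bot$ or $(b_k,c_k)$; sets $\beta=\sqcap\{b_k:c_k=\mathrm{True}\}$ if some $c_k$ is $\mathrm{True}$, and $\beta=b_i$ otherwise; and returns $\beta$ together with the flag that is $\mathrm{True}$ iff either all non-$\bot$ entries $a_k$ and $b_k$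 equal $s$, or no $c_k$ is $\mathrm{False}$ and every $k$ with $a_k\ne\bot$, $a_k\le\beta$ has $b_k\neq\bot$. \textbf{Executions.} An execution is a finite or infinite sequence of invocations (by processes that have no pending operation) and steps (by processes that have one), starting from the initial configuration; a step performs at most one atomic operation on a register or snapshot object. An operation instance is \emph{pending} from its invocation until it returns, and two instances are \emph{concurrent} when they are pending at a common time. In an infinite execution a process is \emph{correct} if it takes infinitely many steps or has no forever-pending operation. Let $\alpha'$ be an infinite execution extending a finite execution $\alpha$. It is \emph{eventually weakly $\alpha$-conflict-free} if it has a suffix in which no two distinct concurrent operation instances that both take at least one step after $\alpha$ have conflicting operations. A finite execution $\alpha$ is \emph{conflict-forgetting} if in every infinite extension of $\alpha$ that is eventually weakly $\alpha$-conflict-free, some correct process, which moreover takes infinitely many steps, completes each of its operations. \textbf{Theorem.} For every sequential object, every $n$, every finite execution $\alpha$ of the algorithm and every process $i$, there is a finite extension of $\alpha$, in which only process $i$ takes steps (and invokes operations) after $\alpha$, that is conflict-forgetting. -/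

import Mathlib

namespace ConflictFree

/-! ### Sequential objects and the conflict relation -/

/-- A sequential data type `(Q, q₀, O, R, σ)`. -/
structure SeqObject (Q O R : Type*) where
  q₀ : Q
  σ : O → Q → R × Q

namespace SeqObject

variable {Q O R : Type*}

/-- `a` and `b` commute in `q`: executing `a` then `b` gives the same responses and the same final
state as executing `b` then `a`. -/
def CommuteIn (A : SeqObject Q O R) (a b : O) (q : Q) : Prop :=
  ∃ (ra rb : R) (q₁ q₂ q' : Q),
    A.σ a q = (ra, q₁) ∧ A.σ b q₁ = (rb, q') ∧ A.σ b q = (rb, q₂) ∧ A.σ a q₂ = (ra, q')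

/-- The conflict relation `a ≍ b`. -/
def Conflict (A : SeqObject Q O R) (a b : O) : Prop := ∃ q, ¬ A.CommuteIn a b q

theorem Conflict.symm {A : SeqObject Q O R} {a b : O} (h : A.Conflict a b) : A.Conflict b a := by
  obtain ⟨q, hq⟩ := h
  refine ⟨q, fun ⟨rb, ra, q₁, q₂, q', h1, h2, h3, h4⟩ => hq ⟨ra, rb, q₂, q₁, q', h3, h4, h1, h2⟩⟩

/-- `σ*`: the responses and states obtained by executing a schedule from `q`. -/
def run (A : SeqObject Q O R) : List O → Q → List (R × Q)
  | [], _ => []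
  | o :: s, q => A.σ o q :: A.run s (A.σ o q).2

end SeqObject

/-! ### Schedules and traces -/

section Occurrences

variable {O : Type*}

open Classical in
/-- Position `k` of the schedule `s` holds the `i`-th occurrence of `a`; positions and occurrences
are counted from `0`. -/
def OccursAt (s : List O) (a : O) (i k : ℕ) : Prop :=
  s[k]? = some a ∧ (s.take k).count a = i

/-- In `s`, the `i`-th occurrence of `a` precedes the `j`-th occurrence of `b`. -/
def OccBefore (s : List O) (a : O) (i : ℕ) (b : O) (j : ℕ) : Prop :=
  ∃ k l, OccursAt s a i k ∧ OccursAt s b j l ∧ k < l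

theorem OccursAt.lt {s : List O} {a : O} {i k : ℕ} (h : OccursAt s a i k) : k < s.length := by
  have := h.1
  rw [List.getElem?_eq_some_iff] at this
  exact this.1

open Classical in
theorem OccursAt.lt_count {s : List O} {a : O} {i k : ℕ} (h : OccursAt s a i k) :
    i < s.count a := by
  have h1 : (s.take (k + 1)).count a = i + 1 := by
    rw [List.take_add_one, List.count_append, h.2, h.1]; simp
  have h2 := (List.take_sublist (k + 1) s).count_le a
  omega

open Classical in
theorem OccursAt.unique {s : List O} {a : O} {i k l : ℕ} (hk : OccursAt s a i k)
    (hl : OccursAt s a i l) : k = l := by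
  have key : ∀ {k l : ℕ}, OccursAt s a i k → OccursAt s a i l → ¬ k < l := by
    intro k l hk hl hlt
    have h1 : (s.take (k + 1)).count a = i + 1 := by
      rw [List.take_add_one, List.count_append, hk.2, hk.1]; simp
    have h2 : (s.take (k + 1)).count a ≤ (s.take l).count a :=
      (List.take_sublist_take_left (by omega)).count_le a
    have h3 := hl.2
    omega
  have h1 := key hk hl
  have h2 := key hl hk
  omega

open Classical in
theorem exists_occursAt {s : List O} {a : O} {i : ℕ} (h : i < s.count a) :
    ∃ k, OccursAt s a i k := by
  induction s generalizing i with
  | nil => simp at h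
  | cons b s ih =>
    by_cases hb : b = a
    · subst hb
      cases i with
      | zero => exact ⟨0, by simp [OccursAt]⟩
      | succ i =>
        rw [List.count_cons_self] at h
        obtain ⟨k, hk⟩ := ih (i := i) (by omega)
        exact ⟨k + 1, by simpa using hk.1, by simpa using hk.2⟩
    · rw [List.count_cons_of_ne hb] at h
      obtain ⟨k, hk⟩ := ih h
      refine ⟨k + 1, by simpa using hk.1, ?_⟩
      rw [List.take_succ_cons, List.count_cons_of_ne hb]
      exact hk.2

open Classical in
theorem occursAt_append_left {x y : List O} {a : O} {i k : ℕ} (hk : k < x.length) :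
    OccursAt (x ++ y) a i k ↔ OccursAt x a i k := by
  unfold OccursAt
  rw [List.getElem?_append_left hk, List.take_append_of_le_length hk.le]

open Classical in
theorem occursAt_append_right {x y : List O} {a : O} {i k : ℕ} :
    OccursAt (x ++ y) a i (x.length + k) ↔
      x.count a ≤ i ∧ OccursAt y a (i - x.count a) k := by
  unfold OccursAt
  rw [List.getElem?_append_right (by omega), List.take_length_add_append, List.count_append]
  simp only [Nat.add_sub_cancel_left]
  constructor
  · rintro ⟨h1, h2⟩
    exact ⟨by omega, h1, by omega⟩
  · rintro ⟨h1, h2, h3⟩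
    exact ⟨h2, by omega⟩

end Occurrences

namespace SeqObject

variable {Q O R : Type*}

/-- Equivalence of schedules: the same operations, and every precedence between occurrences of
conflicting operations is preserved. -/
def Equiv (A : SeqObject Q O R) (s s' : List O) : Prop :=
  (s : Multiset O) = (s' : Multiset O) ∧
    ∀ (a b : O) (i j : ℕ), A.Conflict a b → OccBefore s a i b j → OccBefore s' a i b j

theorem Equiv.symm {A : SeqObject Q O R} {s s' : List O} (h : A.Equiv s s') : A.Equiv s' s := by
  classical
  refine ⟨h.1.symm, ?_⟩
  rintro a b i j hab ⟨k, l, hk, hl, hkl⟩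
  have hp : s.Perm s' := Multiset.coe_eq_coe.1 h.1
  obtain ⟨k', hk'⟩ := exists_occursAt (s := s) (a := a) (i := i)
    (by rw [hp.count_eq]; exact hk.lt_count)
  obtain ⟨l', hl'⟩ := exists_occursAt (s := s) (a := b) (i := j)
    (by rw [hp.count_eq]; exact hl.lt_count)
  rcases lt_trichotomy k' l' with hlt | heq | hgt
  · exact ⟨k', l', hk', hl', hlt⟩
  · subst heq
    have hab' : a = b := by
      have := hk'.1.symm.trans hl'.1
      simpa using this
    subst hab'
    have hij : i = j := hk'.2.symm.trans hl'.2
    subst hij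
    have := hk.unique hl
    omega
  · obtain ⟨l₂, k₂, hl₂, hk₂, hlk⟩ := h.2 b a j i hab.symm ⟨l', k', hl', hk', hgt⟩
    have h1 := hk.unique hk₂
    have h2 := hl.unique hl₂
    omega

/-- The quotient by equivalence of schedules. -/
def traceSetoid (A : SeqObject Q O R) : Setoid (List O) where
  r := A.Equiv
  iseqv :=
    { refl := fun _ => ⟨rfl, fun _ _ _ _ _ h => h⟩
      symm := Equiv.symm
      trans := fun h h' => ⟨h.1.trans h'.1, fun a b i j hab hs => h'.2 a b i j hab (h.2 a b i j hab hs)⟩ }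

theorem Equiv.append {A : SeqObject Q O R} {x x' y y' : List O} (hx : A.Equiv x x')
    (hy : A.Equiv y y') : A.Equiv (x ++ y) (x' ++ y') := by
  classical
  have px : x.Perm x' := Multiset.coe_eq_coe.1 hx.1
  have py : y.Perm y' := Multiset.coe_eq_coe.1 hy.1
  refine ⟨Multiset.coe_eq_coe.2 (px.append py), ?_⟩
  rintro a b i j hab ⟨k, l, hk, hl, hkl⟩
  by_cases hlx : l < x.length
  · have hkx : k < x.length := hkl.trans hlx
    rw [occursAt_append_left hkx] at hk
    rw [occursAt_append_left hlx] at hl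
    obtain ⟨k', l', hk', hl', hkl'⟩ := hx.2 a b i j hab ⟨k, l, hk, hl, hkl⟩
    exact ⟨k', l', (occursAt_append_left hk'.lt).2 hk', (occursAt_append_left hl'.lt).2 hl', hkl'⟩
  · obtain ⟨l₀, rfl⟩ := Nat.exists_eq_add_of_le (not_lt.1 hlx)
    obtain ⟨hjc, hl⟩ := occursAt_append_right.1 hl
    by_cases hkx : k < x.length
    · rw [occursAt_append_left hkx] at hk
      obtain ⟨k', hk'⟩ := exists_occursAt (s := x') (a := a) (i := i)
        (by rw [← px.count_eq]; exact hk.lt_count)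
      obtain ⟨l', hl'⟩ := exists_occursAt (s := y') (a := b) (i := j - x.count b)
        (by rw [← py.count_eq]; exact hl.lt_count)
      refine ⟨k', x'.length + l', (occursAt_append_left hk'.lt).2 hk',
        occursAt_append_right.2 ⟨by rw [← px.count_eq]; exact hjc, ?_⟩, ?_⟩
      · rw [← px.count_eq]; exact hl'
      · have := hk'.lt
        omega
    · obtain ⟨k₀, rfl⟩ := Nat.exists_eq_add_of_le (not_lt.1 hkx)
      obtain ⟨hic, hk⟩ := occursAt_append_right.1 hk
      obtain ⟨k', l', hk', hl', hkl'⟩ := hy.2 a b _ _ hab ⟨k₀, l₀, hk, hl, by omega⟩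
      refine ⟨x'.length + k', x'.length + l', occursAt_append_right.2 ⟨?_, ?_⟩,
        occursAt_append_right.2 ⟨?_, ?_⟩, by omega⟩
      · rw [← px.count_eq]; exact hic
      · rw [← px.count_eq]; exact hk'
      · rw [← px.count_eq]; exact hjc
      · rw [← px.count_eq]; exact hl'

/-- Traces: equivalence classes of schedules. -/
def Trace (A : SeqObject Q O R) : Type _ := Quotient A.traceSetoid

namespace Trace

variable {A : SeqObject Q O R}

/-- The trace `[s]` of a schedule `s`. -/
def mk (s : List O) : A.Trace := Quotient.mk A.traceSetoid s

/-- Traces form a monoid: `[s] * [s'] = [s · s']`, with unit the empty trace. -/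
instance : Monoid A.Trace where
  mul := Quotient.map₂ (fun s s' => s ++ s') (fun _ _ h _ _ h' => Equiv.append h h')
  one := mk []
  mul_assoc := by
    rintro ⟨x⟩ ⟨y⟩ ⟨z⟩
    exact congrArg mk (List.append_assoc x y z)
  one_mul := by
    rintro ⟨x⟩
    rfl
  mul_one := by
    rintro ⟨x⟩
    exact congrArg mk (List.append_nil x)

/-- The prefix order: `x ≤ y` if `y = x * z` for some trace `z`. -/
instance : Preorder A.Trace where
  le x y := ∃ z, y = x * z
  le_refl x := ⟨1, (mul_one x).symm⟩
  le_trans := by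
    rintro x _ _ ⟨u, rfl⟩ ⟨v, rfl⟩
    exact ⟨u * v, mul_assoc x u v⟩

/-- The multiset of operations of a trace. -/
def ops (t : A.Trace) : Multiset O :=
  Quotient.lift (s := A.traceSetoid) (fun s : List O => (s : Multiset O)) (fun _ _ h => And.left h) t

/-- A set of traces is compatible if it has an upper bound in the prefix order. -/
def Comp (S : Set A.Trace) : Prop := BddAbove S

open Classical in
/-- Greatest lower bound in the prefix order (the empty trace if there is none). -/
noncomputable def glb (S : Set A.Trace) : A.Trace := if h : ∃ e, IsGLB S e then h.choose else 1

open Classical in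
/-- Least upper bound in the prefix order (the empty trace if there is none). -/
noncomputable def lub (S : Set A.Trace) : A.Trace := if h : ∃ e, IsLUB S e then h.choose else 1

open Classical in
/-- The return value of (the first occurrence of) `o` in a trace, computed on a representative;
it is `none` only if `o` does not occur in the trace. -/
noncomputable def ret (o : O) (t : A.Trace) : Option R :=
  ((A.run (Quotient.out t) A.q₀)[(Quotient.out t).idxOf o]?).map Prod.fst

end Trace

end SeqObject

/-! ### Commands -/

/-- A command `(op, i, seq)`. -/
structure Command (n : ℕ) (O : Type*) where
  op : O
  proc : Fin n
  seq : ℕ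

/-- The object derived from `A` whose operations are the commands; a command acts as its
underlying operation. -/
def SeqObject.commands {Q O R : Type*} (A : SeqObject Q O R) (n : ℕ) :
    SeqObject Q (Command n O) R where
  q₀ := A.q₀
  σ c q := A.σ c.op q

/-- Traces of commands. -/
abbrev CTrace {Q O R : Type*} (A : SeqObject Q O R) (n : ℕ) : Type _ := (A.commands n).Trace

/-! ### The generalized commit-adopt computations

Each GCA instance uses two atomic snapshot objects, with one entry per process; `none` is `⊥`. -/

section GCA

variable {Q O R : Type*} {A : SeqObject Q O R} {n : ℕ}

/-- From a view `(a_1, …, a_n)` of the first snapshot object, the traces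
`a_k^co = ⊓ ({a_k} ∪ {a_j : a_j and a_k are not compatible})`. -/
noncomputable def gcaCo (a : Fin n → Option (CTrace A n)) : Fin n → Option (CTrace A n) :=
  fun k => (a k).map fun x =>
    SeqObject.Trace.glb ({x} ∪ {y | (∃ j, a j = some y) ∧ ¬ SeqObject.Trace.Comp {y, x}})

open Classical in
/-- The pair `(⊔ a^co, a = a^co)` written to the second snapshot object. -/
noncomputable def gcaCandidate (a : Fin n → Option (CTrace A n)) : CTrace A n × Bool :=
  (SeqObject.Trace.lub {x | ∃ k, gcaCo a k = some x}, decide (a = gcaCo a))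

open Classical in
/-- The output trace `β`, computed from the view `b` of the second snapshot object; `bi` is the
candidate trace of the process itself. -/
noncomputable def gcaOutput (b : Fin n → Option (CTrace A n × Bool)) (bi : CTrace A n) :
    CTrace A n :=
  if ∃ j x, b j = some (x, true) then SeqObject.Trace.glb {x | ∃ k, b k = some (x, true)} else bi

open Classical in
/-- The commit flag, computed from the input `s`, the views `a` and `b` and the output `β`. -/
noncomputable def gcaCommits (s : CTrace A n) (a : Fin n → Option (CTrace A n))
    (b : Fin n → Option (CTrace A n × Bool)) (β : CTrace A n) : Bool :=
  decide
    (((∀ k x, a k = some x → x = s) ∧ (∀ k x c, b k = some (x, c) → x = s)) ∨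
      ((∀ k x, a k = some x → x ≤ β → b k ≠ none) ∧ ¬ ∃ k x, b k = some (x, false)))

end GCA

/-! ### The universal construction: configurations and steps -/

section Algorithm

variable {Q O R : Type*}

/-- The control state of a process. In the constructors `cmd` is the command of the pending
operation and `(r, s)` are the current round and trace. -/
inductive Phase (A : SeqObject Q O R) (n : ℕ) where
  /-- No pending operation. -/
  | idle
  /-- Reading the array `S`: about to read `S[j]`; `(r, s)` has the largest round read so far. -/
  | scan (cmd : Command n O) (j : Fin n) (r : ℕ) (s : CTrace A n)
  /-- Proposing `s` to `GCA_r`: about to write `s` to the first snapshot object. -/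
  | writeA (cmd : Command n O) (r : ℕ) (s : CTrace A n)
  /-- About to take a snapshot of the first snapshot object of `GCA_r`. -/
  | snapA (cmd : Command n O) (r : ℕ) (s : CTrace A n)
  /-- The first snapshot returned `a`; about to write to the second snapshot object of `GCA_r`. -/
  | writeB (cmd : Command n O) (r : ℕ) (s : CTrace A n) (a : Fin n → Option (CTrace A n))
  /-- About to take a snapshot of the second snapshot object of `GCA_r`. -/
  | snapB (cmd : Command n O) (r : ℕ) (s : CTrace A n) (a : Fin n → Option (CTrace A n))
  /-- The loop is over: about to write `(r, s)` to the own entry of `S`. -/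
  | publish (cmd : Command n O) (r : ℕ) (s : CTrace A n)
  /-- About to return the response of `cmd` in `s`. -/
  | respond (cmd : Command n O) (s : CTrace A n)

/-- The command of the pending operation, if there is one. -/
def Phase.pending {A : SeqObject Q O R} {n : ℕ} : Phase A n → Option (Command n O)
  | .idle => none
  | .scan cmd _ _ _ => some cmd
  | .writeA cmd _ _ => some cmd
  | .snapA cmd _ _ => some cmd
  | .writeB cmd _ _ _ => some cmd
  | .snapB cmd _ _ _ => some cmd
  | .publish cmd _ _ => some cmd
  | .respond cmd _ => some cmd

open Classical in
/-- The head of the while loop, with current round `r`, trace `s` and flag `c`: if `cmd ∉ s` or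
`c` is false, move to round `r + 1` and propose `s`, extended with `cmd` if it is absent;
otherwise leave the loop. -/
noncomputable def Phase.loop {A : SeqObject Q O R} {n : ℕ} (cmd : Command n O) (r : ℕ)
    (s : CTrace A n) (c : Bool) : Phase A n :=
  if cmd ∉ s.ops ∨ c = false then
    .writeA cmd (r + 1) (if cmd ∉ s.ops then s * SeqObject.Trace.mk [cmd] else s)
  else .publish cmd r s

/-- The local state of a process: its sequence number, its control state and the response of its
last completed operation. -/
structure LocalState (A : SeqObject Q O R) (n : ℕ) where
  seq : ℕ
  phase : Phase A n
  response : Option R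

/-- A configuration: the array `S` of registers, the two snapshot objects of each `GCA_r`, and the
local states. -/
structure Config (A : SeqObject Q O R) (n : ℕ) where
  S : Fin n → ℕ × CTrace A n
  snA : ℕ → Fin n → Option (CTrace A n)
  snB : ℕ → Fin n → Option (CTrace A n × Bool)
  loc : Fin n → LocalState A n

/-- The initial configuration. -/
def Config.init (A : SeqObject Q O R) (n : ℕ) : Config A n where
  S _ := (0, 1)
  snA _ _ := none
  snB _ _ := none
  loc _ := { seq := 0, phase := .idle, response := none }

/-- The events of an execution: process `i` invokes an operation, or takes a step of its pending
operation. A step comprises at most one operation on a register or snapshot object, together with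
local computation; the response of an operation is its last step. -/
inductive Event (n : ℕ) (O : Type*) where
  | invoke (i : Fin n) (o : O)
  | step (i : Fin n)

/-- The process of an event. -/
def Event.proc {n : ℕ} : Event n O → Fin n
  | .invoke i _ => i
  | .step i => i

namespace Config

variable {A : SeqObject Q O R} {n : ℕ}

/-- The command of the pending operation of process `i`, if there is one. -/
def pending (C : Config A n) (i : Fin n) : Option (Command n O) := (C.loc i).phase.pending

/-- A process invokes an operation only when it has none pending, and it takes steps only when it
has one pending. -/
def Enabled (C : Config A n) : Event n O → Prop
  | .invoke i _ => C.pending i = none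
  | .step i => C.pending i ≠ none

/-- Change the control state of process `i`. -/
def setPhase (C : Config A n) (i : Fin n) (p : Phase A n) : Config A n :=
  { C with loc := Function.update C.loc i { C.loc i with phase := p } }

/-- The effect of an event. -/
noncomputable def next (C : Config A n) : Event n O → Config A n
  | .invoke i o =>
    { C with
      loc := Function.update C.loc i
        { C.loc i with
          seq := (C.loc i).seq + 1
          phase := .scan ⟨o, i, (C.loc i).seq + 1⟩ ⟨0, i.pos⟩ 0 1 } }
  | .step i =>
    match (C.loc i).phase with
    | .idle => C
    | .scan cmd j r s =>
      -- read `S[j]`, keep the pair with the larger round, and go on with the next entry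
      let m : ℕ × CTrace A n := if r < (C.S j).1 then C.S j else (r, s)
      if h : j.val + 1 < n then C.setPhase i (.scan cmd ⟨j.val + 1, h⟩ m.1 m.2)
      else C.setPhase i (.loop cmd m.1 m.2 false)
    | .writeA cmd r s =>
      { C with snA := Function.update C.snA r (Function.update (C.snA r) i (some s)) }.setPhase i
        (.snapA cmd r s)
    | .snapA cmd r s => C.setPhase i (.writeB cmd r s (C.snA r))
    | .writeB cmd r s a =>
      { C with
        snB := Function.update C.snB r
          (Function.update (C.snB r) i (some (gcaCandidate a))) }.setPhase i (.snapB cmd r s a)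
    | .snapB cmd r s a =>
      let β := gcaOutput (C.snB r) (gcaCandidate a).1
      C.setPhase i (.loop cmd r β (gcaCommits s a (C.snB r) β))
    | .publish cmd r s =>
      { C with S := Function.update C.S i (r, s) }.setPhase i (.respond cmd s)
    | .respond cmd s =>
      { C with
        loc := Function.update C.loc i
          { C.loc i with phase := .idle, response := SeqObject.Trace.ret cmd s } }

/-- The events of the list can be executed, in this order, from `C`. -/
def Executes (C : Config A n) : List (Event n O) → Prop
  | [] => True
  | ev :: l => C.Enabled ev ∧ (C.next ev).Executes l

end Config

/-! ### Executions and progress -/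

variable (A : SeqObject Q O R) {n : ℕ}

/-- Finite executions. The algorithm is deterministic, so an execution is given by its events. -/
def IsFiniteExecution (α : List (Event n O)) : Prop := (Config.init A n).Executes α

/-- The configuration reached after the first `t` events of `e`. -/
noncomputable def configAt (e : ℕ → Event n O) : ℕ → Config A n
  | 0 => Config.init A n
  | t + 1 => (configAt e t).next (e t)

/-- Infinite executions. -/
def IsInfiniteExecution (e : ℕ → Event n O) : Prop := ∀ t, (configAt A e t).Enabled (e t)

/-- The infinite sequence `e` extends the finite sequence `α`. -/
def Extends (e : ℕ → Event n O) (α : List (Event n O)) : Prop :=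
  ∀ (k : ℕ) (h : k < α.length), e k = α[k]

/-- The operation instance with command `Φ` is pending at time `t`. Instances are identified with
their commands, since each invocation creates a fresh command. -/
def PendingAt (e : ℕ → Event n O) (t : ℕ) (Φ : Command n O) : Prop :=
  (configAt A e t).pending Φ.proc = some Φ

/-- The operation instance `Φ` takes a step at time `m` or later. -/
def TakesStepFrom (e : ℕ → Event n O) (m : ℕ) (Φ : Command n O) : Prop :=
  ∃ t ≥ m, e t = Event.step Φ.proc ∧ PendingAt A e t Φ

/-- `e` is eventually weakly `α`-conflict-free, where `α` is its prefix of length `m`: there is a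
suffix of `e` in which no two concurrent operation instances that take steps after `α` conflict. -/
def EventuallyWeaklyConflictFree (e : ℕ → Event n O) (m : ℕ) : Prop :=
  ∃ T, ∀ t ≥ T, ∀ Φ Φ' : Command n O, Φ ≠ Φ' → PendingAt A e t Φ → PendingAt A e t Φ' →
    TakesStepFrom A e m Φ → TakesStepFrom A e m Φ' → ¬ A.Conflict Φ.op Φ'.op

/-- Process `j` takes infinitely many steps. -/
def TakesInfinitelyManySteps (e : ℕ → Event n O) (j : Fin n) : Prop :=
  ∀ T, ∃ t ≥ T, e t = Event.step j

/-- Every operation invoked by `j` completes. -/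
def CompletesAll (e : ℕ → Event n O) (j : Fin n) : Prop :=
  ∀ t, ∀ Φ : Command n O, Φ.proc = j → PendingAt A e t Φ → ∃ t' ≥ t, ¬ PendingAt A e t' Φ

/-- Process `j` is correct: it takes infinitely many steps, or it has no pending operation (no
invocation without a matching response). -/
def Correct (e : ℕ → Event n O) (j : Fin n) : Prop :=
  TakesInfinitelyManySteps e j ∨ ¬ ∃ T Φ, Φ.proc = j ∧ ∀ t ≥ T, PendingAt A e t Φ

/-- A finite execution `α` is conflict-forgetting if in each of its infinite extensions that is
eventually weakly `α`-conflict-free, some correct process, one that keeps taking steps, completes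
each of its operations. (A process that invokes no operation is correct and completes all of its
operations for an empty reason, so the process is asked to take infinitely many steps.) -/
def ConflictForgetting (α : List (Event n O)) : Prop :=
  ∀ e : ℕ → Event n O, IsInfiniteExecution A e → Extends e α →
    EventuallyWeaklyConflictFree A e α.length →
    ∃ j, Correct A e j ∧ TakesInfinitelyManySteps e j ∧ CompletesAll A e j

end Algorithm

end ConflictFree

namespace ConflictFree

namespace SeqObject

namespace Trace

variable {Q O R : Type*} {A : SeqObject Q O R}

/-! ### The trace monoid -/

/-! After `α`, let process `i` run alone, invoking one operation after another, until it is idle and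
its register carries a round `r` larger than the length of `α`. An event raises the largest round in
use by at most one, so no other process has reached round `r`. From then on every output of `GCA_r`
equals the trace stored by `i`: it extends that trace by agreement, and it lies below it because the
flagged candidate of `i` stays visible (`output_eq`). Commands of stalled processes that slower
processes still carry in earlier rounds are thus dropped at round `r` unless already stored: from
there on a trace contains only commands of the stored trace and commands whose instance takes a step
after the extension (`mem_or_takesStepFrom`). This is how conflicts are forgotten.

Suppose now that in an infinite extension no process with infinitely many steps completes all its
operations. Eventually only processes with a forever pending operation act, and the registers are
constant (`eventually_starving`). Let `s₀` be the stored trace of largest round. Proposals of late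
rounds have the form `s₀ * z`. Traces contain each command at most once, and a command in a trace is
pending or stored by its process, so the commands of `z` are pending and take a step after the
extension. By conflict-freedom they commute, hence the proposals of late rounds are pairwise
compatible.

A late round with compatible proposals lets some process leave the loop (`no_starvation`), a
contradiction. In such a round all candidates are flagged and form a chain. Let `b` be the least
one; it belongs to the first snapshot of `A`. Among the processes whose proposals lie below `b`, the
last one to write to `B` sees all the entries of `B` that the commit rule requires, outputs `b` and
commits; its own command lies in `b`. The same lemma, for one process, shows that solo operations
complete, which yields the solo extension.

Underneath lie the order theory of the trace monoid (cancellation, joins of finite pairwise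
compatible families, meets of nonempty sets), the write-once property of snapshot entries, agreement
within a round, and `value_induction`, which propagates invariants of traces through the rounds. -/

theorem exists_rep (x : A.Trace) : ∃ s : List O, mk s = x := Quotient.exists_rep x

theorem mk_mul_mk (s s' : List O) : (mk s * mk s' : A.Trace) = mk (s ++ s') := rfl

theorem mk_nil : (mk [] : A.Trace) = 1 := rfl

theorem mk_eq_mk {s s' : List O} : (mk s : A.Trace) = mk s' ↔ A.Equiv s s' :=
  ⟨fun h => Quotient.exact h, fun h => Quotient.sound h⟩

theorem ops_mk (s : List O) : (mk s : A.Trace).ops = (s : Multiset O) := rfl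

theorem ops_one : (1 : A.Trace).ops = 0 := rfl

theorem ops_mul (x y : A.Trace) : (x * y).ops = x.ops + y.ops := by
  obtain ⟨s, rfl⟩ := exists_rep x
  obtain ⟨s', rfl⟩ := exists_rep y
  rfl

theorem eq_one_of_ops_eq_zero {x : A.Trace} (h : x.ops = 0) : x = 1 := by
  obtain ⟨s, rfl⟩ := exists_rep x
  rw [ops_mk, Multiset.coe_eq_zero] at h
  rw [h, mk_nil]

theorem mem_ops_mul {x y : A.Trace} {c : O} : c ∈ (x * y).ops ↔ c ∈ x.ops ∨ c ∈ y.ops := by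
  rw [ops_mul, Multiset.mem_add]

theorem le_mul_right (x y : A.Trace) : x ≤ x * y := ⟨y, rfl⟩

theorem one_le (x : A.Trace) : 1 ≤ x := ⟨x, (one_mul x).symm⟩

theorem mul_le_mul_left' (x : A.Trace) {y z : A.Trace} (h : y ≤ z) : x * y ≤ x * z := by
  obtain ⟨w, rfl⟩ := h
  exact ⟨w, (mul_assoc _ _ _).symm⟩

theorem ops_le {x y : A.Trace} (h : x ≤ y) : x.ops ≤ y.ops := by
  obtain ⟨w, rfl⟩ := h
  rw [ops_mul]
  exact Multiset.le_add_right _ _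

theorem le_antisymm {x y : A.Trace} (h : x ≤ y) (h' : y ≤ x) : x = y := by
  have hc : x.ops = y.ops := _root_.le_antisymm (ops_le h) (ops_le h')
  obtain ⟨w, rfl⟩ := h
  rw [ops_mul] at hc
  rw [eq_one_of_ops_eq_zero (left_eq_add.1 hc), mul_one]

-- A common first letter shifts every position by one and every occurrence index of `a` by one, so
-- precedences transfer between the lists with and without it.
open Classical in
theorem mk_cons_cancel {a : O} {x y : List O} (h : (mk (a :: x) : A.Trace) = mk (a :: y)) :
    (mk x : A.Trace) = mk y := by
  rw [mk_eq_mk] at h ⊢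
  have hm : (x : Multiset O) = y := by
    have h1 := h.1
    rw [← Multiset.cons_coe, ← Multiset.cons_coe] at h1
    exact (Multiset.cons_inj_right a).1 h1
  refine ⟨hm, ?_⟩
  rintro b c i j hbc ⟨k, l, hk, hl, hkl⟩
  have lift : ∀ {z : List O} {d : O} {p q : ℕ},
      OccursAt z d p q ↔ OccursAt ([a] ++ z) d ([a].count d + p) ([a].length + q) := by
    intro z d p q
    rw [occursAt_append_right]
    simp
  obtain ⟨k', l', hk', hl', hkl'⟩ := h.2 b c _ _ hbc ⟨_, _, lift.1 hk, lift.1 hl, by omega⟩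
  have pos : ∀ {d : O} {p q : ℕ}, OccursAt (a :: y) d ([a].count d + p) q → 1 ≤ q := by
    intro d p q hq
    by_contra h0
    obtain rfl : q = 0 := by omega
    have h1 : a = d := by simpa using hq.1
    subst h1
    have h2 := hq.2
    simp at h2
    omega
  obtain ⟨k₀, rfl⟩ := Nat.exists_eq_add_of_le (pos hk')
  obtain ⟨l₀, rfl⟩ := Nat.exists_eq_add_of_le (pos hl')
  exact ⟨k₀, l₀, lift.2 hk', lift.2 hl', by omega⟩

theorem mul_left_cancel' {x y z : A.Trace} (h : x * y = x * z) : y = z := by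
  obtain ⟨s, rfl⟩ := exists_rep x
  obtain ⟨t, rfl⟩ := exists_rep y
  obtain ⟨u, rfl⟩ := exists_rep z
  rw [mk_mul_mk, mk_mul_mk] at h
  induction s with
  | nil => exact h
  | cons a s ih => exact ih (mk_cons_cancel h)

theorem le_of_mul_le_mul_left' {x y z : A.Trace} (h : x * y ≤ x * z) : y ≤ z := by
  obtain ⟨w, hw⟩ := h
  rw [mul_assoc] at hw
  exact ⟨w, mul_left_cancel' hw⟩

/-! ### Commutation and minimal operations of a trace. -/

theorem mk_mul_comm {a b : O} (h : a = b ∨ ¬ A.Conflict a b) :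
    (mk [a] * mk [b] : A.Trace) = mk [b] * mk [a] := by
  rcases h with rfl | h
  · rfl
  · rw [mk_mul_mk, mk_mul_mk, mk_eq_mk]
    refine ⟨Multiset.coe_eq_coe.2 (List.Perm.swap _ _ _), ?_⟩
    rintro c d i j hcd ⟨k, l, hk, hl, hkl⟩
    have := hl.lt
    simp at this
    obtain rfl : k = 0 := by omega
    obtain rfl : l = 1 := by omega
    have h1 : a = c := by simpa using hk.1
    have h2 : b = d := by simpa using hl.1
    subst h1 h2
    exact absurd hcd h

theorem atom_mul_comm {a : O} {y : A.Trace} (h : ∀ b ∈ y.ops, a = b ∨ ¬ A.Conflict a b) :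
    mk [a] * y = y * mk [a] := by
  obtain ⟨s, rfl⟩ := exists_rep y
  rw [ops_mk] at h
  induction s with
  | nil => rfl
  | cons b s ih =>
    have h1 : (mk (b :: s) : A.Trace) = mk [b] * mk s := rfl
    rw [h1, ← mul_assoc, mk_mul_comm (h b (by simp)), mul_assoc,
      ih (fun c hc => h c (by simp at hc ⊢; exact Or.inr hc)), mul_assoc]

theorem mul_comm_of_forall {x y : A.Trace}
    (h : ∀ a ∈ x.ops, ∀ b ∈ y.ops, a = b ∨ ¬ A.Conflict a b) : x * y = y * x := by
  obtain ⟨s, rfl⟩ := exists_rep x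
  rw [ops_mk] at h
  induction s with
  | nil => rw [mk_nil, one_mul, mul_one]
  | cons a s ih =>
    have h1 : (mk (a :: s) : A.Trace) = mk [a] * mk s := rfl
    rw [h1, mul_assoc, ih (fun c hc => h c (by simp at hc ⊢; exact Or.inr hc)), ← mul_assoc,
      atom_mul_comm (h a (by simp)), mul_assoc]

-- Some representative starts with `a`. An operation in front of the first `a` of `s` that conflicts
-- with `a` would have to precede the first `a` there too.
open Classical in
theorem exists_eq_append_of_atom_le {a : O} {s : List O} (h : (mk [a] : A.Trace) ≤ mk s) :
    ∃ l₁ l₂, s = l₁ ++ a :: l₂ ∧ ∀ b ∈ l₁, b ≠ a ∧ ¬ A.Conflict a b := by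
  obtain ⟨w, hw⟩ := h
  obtain ⟨s', rfl⟩ := exists_rep w
  rw [mk_mul_mk, mk_eq_mk] at hw
  have ha : a ∈ s := (Multiset.coe_eq_coe.1 hw.1).mem_iff.2 (by simp)
  obtain ⟨l₁, l₂, rfl, hl₁⟩ := List.eq_append_cons_of_mem ha
  refine ⟨l₁, l₂, rfl, fun b hb => ⟨fun hba => hl₁ (hba ▸ hb), fun hc => ?_⟩⟩
  obtain ⟨k, hk⟩ := exists_occursAt (s := l₁) (a := b) (i := 0) (List.count_pos_iff.2 hb)
  have hal : OccursAt (l₁ ++ a :: l₂) a 0 l₁.length := by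
    refine ⟨by simp, ?_⟩
    simpa [List.count_eq_zero] using hl₁
  obtain ⟨k', l', -, hl', hkl'⟩ := hw.2 b a 0 0 hc.symm
    ⟨k, l₁.length, (occursAt_append_left hk.lt).2 hk, hal, hk.lt⟩
  have h0 : OccursAt ([a] ++ s') a 0 0 := ⟨by simp, by simp⟩
  have := hl'.unique h0
  omega

theorem atom_le_of_eq_append {a : O} {l₁ l₂ : List O}
    (h : ∀ b ∈ l₁, b ≠ a ∧ ¬ A.Conflict a b) : (mk [a] : A.Trace) ≤ mk (l₁ ++ a :: l₂) := by
  refine ⟨mk l₁ * mk l₂, ?_⟩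
  have h1 : (mk (l₁ ++ a :: l₂) : A.Trace) = mk l₁ * (mk [a] * mk l₂) := rfl
  rw [h1, ← mul_assoc, ← mul_assoc, atom_mul_comm (y := mk l₁) (fun b hb => Or.inr (h b hb).2)]

/-- A minimal operation of `y * w` that is not minimal in `y` is independent of `y`. -/
theorem atom_le_mul {a : O} {y w : A.Trace} (h : mk [a] ≤ y * w) (hy : ¬ mk [a] ≤ y) :
    (∀ b ∈ y.ops, b ≠ a ∧ ¬ A.Conflict a b) ∧ mk [a] ≤ w := by
  obtain ⟨s, rfl⟩ := exists_rep y
  obtain ⟨s', rfl⟩ := exists_rep w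
  obtain ⟨l₁, l₂, hs, hl⟩ := exists_eq_append_of_atom_le h
  have key : ∀ m, l₁ = s ++ m → s' = m ++ a :: l₂ →
      (∀ b ∈ (mk s : A.Trace).ops, b ≠ a ∧ ¬ A.Conflict a b) ∧ (mk [a] : A.Trace) ≤ mk s' := by
    rintro m rfl rfl
    exact ⟨fun b hb => hl b (List.mem_append_left _ hb),
      atom_le_of_eq_append fun b hb => hl b (List.mem_append_right _ hb)⟩
  rcases List.append_eq_append_iff.1 hs with ⟨m, h1, h2⟩ | ⟨m, h1, h2⟩
  · exact key m h1 h2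
  · cases m with
    | nil => exact key [] (by simpa using h1.symm) (by simpa using h2.symm)
    | cons b m =>
      obtain ⟨rfl, rfl⟩ : a = b ∧ l₂ = m ++ s' := by simpa using h2
      subst h1
      exact absurd (atom_le_of_eq_append hl) hy

/-- The exchange step for joins: a minimal operation of `u` that is missing at the bottom of `y`
commutes past all of `y`, so `mk [a] * y` acts as the join of `mk [a]` and `y`. -/
theorem atom_mul_le {a : O} {y u : A.Trace} (ha : mk [a] ≤ u) (hy : y ≤ u) (hay : ¬ mk [a] ≤ y) :
    (∀ b ∈ y.ops, b ≠ a) ∧ mk [a] * y = y * mk [a] ∧ mk [a] * y ≤ u := by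
  obtain ⟨w, rfl⟩ := hy
  obtain ⟨h1, h2⟩ := atom_le_mul ha hay
  have hc : mk [a] * y = y * mk [a] := atom_mul_comm fun b hb => Or.inr (h1 b hb).2
  exact ⟨fun b hb => (h1 b hb).1, hc, hc ▸ mul_le_mul_left' y h2⟩

/-! ### Bounds -/

theorem comp_pair {x y : A.Trace} : Comp {x, y} ↔ ∃ u, x ≤ u ∧ y ≤ u := by
  constructor
  · rintro ⟨u, hu⟩
    exact ⟨u, hu (by simp), hu (by simp)⟩
  · rintro ⟨u, h1, h2⟩
    refine ⟨u, ?_⟩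
    rintro z (rfl | rfl)
    · exact h1
    · exact h2

open Classical in
/-- Two compatible traces have a least upper bound, in which no operation occurs more often than
in both of them. -/
theorem exists_isLUB_pair {x y : A.Trace} (h : Comp {x, y}) :
    ∃ l, (∀ u, l ≤ u ↔ x ≤ u ∧ y ≤ u) ∧ ∀ c, l.ops.count c ≤ max (x.ops.count c) (y.ops.count c) := by
  obtain ⟨u, hx, hy⟩ := comp_pair.1 h
  clear h
  obtain ⟨s, rfl⟩ := exists_rep x
  induction s generalizing y u with
  | nil =>
    exact ⟨y, fun v => ⟨fun h => ⟨one_le v, h⟩, And.right⟩, fun c => le_max_right _ _⟩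
  | cons a s ih =>
    have hs : (mk (a :: s) : A.Trace) = mk [a] * mk s := rfl
    have hau : mk [a] ≤ u := (le_mul_right _ _).trans (hs ▸ hx)
    obtain ⟨u', rfl⟩ := hau
    have hx' : mk s ≤ u' := le_of_mul_le_mul_left' (hs ▸ hx)
    -- Everything is divided by the first letter `a`. If `a` is minimal in `y`, it is cancelled
    -- there as well; otherwise `y` is first replaced by `mk [a] * y`, which has the same upper
    -- bounds among the traces above `mk [a]`.
    by_cases hay : mk [a] ≤ y
    · obtain ⟨y', rfl⟩ := hay
      obtain ⟨l, hl, hc⟩ := ih u' (le_of_mul_le_mul_left' hy) hx'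
      refine ⟨mk [a] * l, fun v => ⟨fun h => ?_, fun ⟨h1, h2⟩ => ?_⟩, fun c => ?_⟩
      · have := (hl l).1 le_rfl
        exact ⟨hs ▸ (mul_le_mul_left' _ this.1).trans h, (mul_le_mul_left' _ this.2).trans h⟩
      · obtain ⟨v', rfl⟩ := (le_mul_right _ _).trans h2
        exact mul_le_mul_left' _ ((hl v').2 ⟨le_of_mul_le_mul_left' (hs ▸ h1),
          le_of_mul_le_mul_left' h2⟩)
      · have := hc c
        simp only [hs, ops_mul, Multiset.count_add]
        omega
    · obtain ⟨hne, hcomm, hle⟩ := atom_mul_le (le_mul_right _ _) hy hay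
      obtain ⟨l, hl, hc⟩ := ih u' (le_of_mul_le_mul_left' hle) hx'
      have hll := (hl l).1 le_rfl
      refine ⟨mk [a] * l, fun v => ⟨fun h => ⟨?_, ?_⟩, fun ⟨h1, h2⟩ => ?_⟩, fun c => ?_⟩
      · exact hs ▸ (mul_le_mul_left' _ hll.1).trans h
      · have h1 : y ≤ mk [a] * y := hcomm ▸ le_mul_right _ _
        exact h1.trans ((mul_le_mul_left' _ hll.2).trans h)
      · have hav : mk [a] ≤ v := (le_mul_right _ _).trans (hs ▸ h1)
        have hle' := (atom_mul_le hav h2 hay).2.2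
        obtain ⟨v', rfl⟩ := hav
        exact mul_le_mul_left' _ ((hl v').2 ⟨le_of_mul_le_mul_left' (hs ▸ h1),
          le_of_mul_le_mul_left' hle'⟩)
      · have := hc c
        simp only [hs, ops_mul, Multiset.count_add]
        by_cases hca : c = a
        · subst hca
          have h0 : y.ops.count c = 0 :=
            Multiset.count_eq_zero.2 fun hm => hne c hm rfl
          omega
        · have h0 : (mk [a] : A.Trace).ops.count c = 0 := by
            rw [ops_mk]
            simpa using fun h => hca h
          omega

/-- Three pairwise compatible traces have a common upper bound. -/
theorem exists_upperBound_triple {x y z : A.Trace} (hxy : Comp {x, y}) (hxz : Comp {x, z})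
    (hyz : Comp {y, z}) : ∃ u, x ≤ u ∧ y ≤ u ∧ z ≤ u := by
  obtain ⟨s, rfl⟩ := exists_rep x
  induction s generalizing y z with
  | nil =>
    obtain ⟨u, h1, h2⟩ := comp_pair.1 hyz
    exact ⟨u, one_le u, h1, h2⟩
  | cons a s ih =>
    have hs : (mk (a :: s) : A.Trace) = mk [a] * mk s := rfl
    -- the residual of a trace after `a`
    have res : ∀ y : A.Trace, Comp {mk (a :: s), y} → ∃ y', Comp {mk s, y'} ∧ y ≤ mk [a] * y' ∧
        (∀ v, mk [a] ≤ v → y ≤ v → mk [a] * y' ≤ v) ∧ (y = mk [a] * y' ∨ y = y') := by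
      intro y hy
      obtain ⟨u, h1, h2⟩ := comp_pair.1 hy
      have hau : mk [a] ≤ u := (le_mul_right _ _).trans (hs ▸ h1)
      by_cases hay : mk [a] ≤ y
      · obtain ⟨y', rfl⟩ := hay
        obtain ⟨u', rfl⟩ := hau
        exact ⟨y', comp_pair.2 ⟨u', le_of_mul_le_mul_left' (hs ▸ h1), le_of_mul_le_mul_left' h2⟩,
          le_rfl, fun v _ h => h, Or.inl rfl⟩
      · obtain ⟨-, hcomm, hle⟩ := atom_mul_le hau h2 hay
        obtain ⟨u', rfl⟩ := hau
        exact ⟨y, comp_pair.2 ⟨u', le_of_mul_le_mul_left' (hs ▸ h1), le_of_mul_le_mul_left' hle⟩,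
          hcomm ▸ le_mul_right _ _, fun v hv hyv => (atom_mul_le hv hyv hay).2.2, Or.inr rfl⟩
    obtain ⟨y', hy1, hy2, hy3, hy4⟩ := res y hxy
    obtain ⟨z', hz1, hz2, hz3, hz4⟩ := res z hxz
    have hyz' : Comp {y', z'} := by
      obtain ⟨u, h1, h2⟩ := comp_pair.1 hyz
      by_cases hau : mk [a] ≤ u
      · have h3 := hy3 u hau h1
        have h4 := hz3 u hau h2
        obtain ⟨u', rfl⟩ := hau
        exact comp_pair.2 ⟨u', le_of_mul_le_mul_left' h3, le_of_mul_le_mul_left' h4⟩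
      -- An upper bound that is not above `a` forces `a` to be minimal in neither trace, so both
      -- residuals are the original traces.
      · rcases hy4 with rfl | rfl
        · exact absurd ((le_mul_right _ _).trans h1) hau
        · rcases hz4 with rfl | rfl
          · exact absurd ((le_mul_right _ _).trans h2) hau
          · exact hyz
    obtain ⟨u, h1, h2, h3⟩ := ih hyz' hy1 hz1
    exact ⟨mk [a] * u, hs ▸ mul_le_mul_left' _ h1, hy2.trans (mul_le_mul_left' _ h2),
      hz2.trans (mul_le_mul_left' _ h3)⟩

open Classical in
/-- A finite set of pairwise compatible traces has a least upper bound, and an operation occurs in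
it no more often than in all of the traces. -/
theorem exists_isLUB {S : Set A.Trace} (hS : S.Finite) (h : ∀ x ∈ S, ∀ y ∈ S, Comp {x, y}) :
    ∃ l, IsLUB S l ∧ ∀ c N, (∀ x ∈ S, x.ops.count c ≤ N) → l.ops.count c ≤ N := by
  -- The extra clause, that a trace compatible with every element is compatible with the join, keeps
  -- the induction going; it comes from `exists_upperBound_triple`.
  suffices H : ∃ l, IsLUB S l ∧ (∀ c N, (∀ x ∈ S, x.ops.count c ≤ N) → l.ops.count c ≤ N) ∧
      ∀ z, (∀ x ∈ S, Comp {x, z}) → Comp {l, z} by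
    obtain ⟨l, h1, h2, -⟩ := H
    exact ⟨l, h1, h2⟩
  induction S, hS using Set.Finite.induction_on with
  | empty =>
    refine ⟨1, ⟨by simp, fun u _ => one_le u⟩, fun c N _ => by simp [ops_one], fun z _ => ?_⟩
    exact comp_pair.2 ⟨z, one_le z, le_rfl⟩
  | @insert x S _ _ ih =>
    obtain ⟨l, hl, hc, hz⟩ := ih fun x hx y hy => h x (Or.inr hx) y (Or.inr hy)
    have hlx : Comp {l, x} := hz x fun y hy => h y (Or.inr hy) x (Or.inl rfl)
    obtain ⟨l', hl', hc'⟩ := exists_isLUB_pair hlx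
    refine ⟨l', ⟨?_, fun u hu => ?_⟩, fun c N hN => ?_, fun z hzS => ?_⟩
    · have := (hl' l').1 le_rfl
      rintro y (rfl | hy)
      · exact this.2
      · exact (hl.1 hy).trans this.1
    · exact (hl' u).2 ⟨hl.2 fun y hy => hu (Or.inr hy), hu (Or.inl rfl)⟩
    · exact (hc' c).trans (max_le (hc c N fun y hy => hN y (Or.inr hy)) (hN x (Or.inl rfl)))
    · obtain ⟨u, h1, h2, h3⟩ := exists_upperBound_triple hlx
        (hz z fun y hy => hzS y (Or.inr hy)) (hzS x (Or.inl rfl))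
      exact comp_pair.2 ⟨u, (hl' u).2 ⟨h1, h2⟩, h3⟩

/-- A nonempty set of traces has a greatest lower bound. -/
theorem exists_isGLB {S : Set A.Trace} (hS : S.Nonempty) : ∃ g, IsGLB S g := by
  obtain ⟨y, hy⟩ := hS
  -- Take a lower bound with the most operations. Its join with any other lower bound exists, both
  -- being below `y`, and is again a lower bound, so by maximality it adds nothing.
  obtain ⟨g, hg, hmax⟩ : ∃ g ∈ lowerBounds S, ∀ h ∈ lowerBounds S, h.ops.card ≤ g.ops.card := by
    have hb : BddAbove ((fun h : A.Trace => h.ops.card) '' lowerBounds S) := by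
      refine ⟨y.ops.card, ?_⟩
      rintro _ ⟨h, hh, rfl⟩
      exact Multiset.card_le_card (ops_le (hh hy))
    obtain ⟨g, hg, hgm⟩ := Nat.sSup_mem (s := (fun h : A.Trace => h.ops.card) '' lowerBounds S)
      ⟨_, 1, fun x _ => one_le x, rfl⟩ hb
    refine ⟨g, hg, fun h hh => ?_⟩
    have := le_csSup hb ⟨h, hh, rfl⟩
    rwa [← hgm] at this
  refine ⟨g, hg, fun h hh => ?_⟩
  obtain ⟨l, hl, -⟩ := exists_isLUB_pair (x := g) (y := h) (comp_pair.2 ⟨y, hg hy, hh hy⟩)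
  obtain ⟨⟨w, hw⟩, hhl⟩ := (hl l).1 le_rfl
  have hlm := hmax l fun x hx => (hl x).2 ⟨hg hx, hh hx⟩
  rw [hw, ops_mul, Multiset.card_add] at hlm
  have hw1 : w = 1 := eq_one_of_ops_eq_zero (Multiset.card_eq_zero.1 (by omega))
  rw [hw, hw1, mul_one] at hhl
  exact hhl

/-! ### Evaluation of `glb` and `lub` when the bounds exist. -/

theorem isGLB_glb {S : Set A.Trace} (hS : S.Nonempty) : IsGLB S (glb S) := by
  have h := exists_isGLB hS
  rw [glb, dif_pos h]
  exact h.choose_spec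

theorem glb_eq {S : Set A.Trace} {g : A.Trace} (h : IsGLB S g) : glb S = g := by
  have h' : ∃ e, IsGLB S e := ⟨g, h⟩
  rw [glb, dif_pos h']
  have := h'.choose_spec
  exact le_antisymm (h.2 this.1) (this.2 h.1)

theorem lub_eq {S : Set A.Trace} {l : A.Trace} (h : IsLUB S l) : lub S = l := by
  have h' : ∃ e, IsLUB S e := ⟨l, h⟩
  rw [lub, dif_pos h']
  have := h'.choose_spec
  exact le_antisymm (this.2 h.1) (h.2 this.1)

theorem isLUB_lub {S : Set A.Trace} (hS : S.Finite) (h : ∀ x ∈ S, ∀ y ∈ S, Comp {x, y}) :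
    IsLUB S (lub S) := by
  obtain ⟨l, hl, -⟩ := exists_isLUB hS h
  rwa [lub_eq hl]

open Classical in
theorem count_lub_le {S : Set A.Trace} (hS : S.Finite) (h : ∀ x ∈ S, ∀ y ∈ S, Comp {x, y})
    {c : O} {N : ℕ} (hN : ∀ x ∈ S, x.ops.count c ≤ N) : (lub S).ops.count c ≤ N := by
  obtain ⟨l, hl, hc⟩ := exists_isLUB hS h
  rw [lub_eq hl]
  exact hc c N hN

end Trace

end SeqObject

section GCA

open SeqObject.Trace

variable {Q O R : Type*} {A : SeqObject Q O R} {n : ℕ}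

/-! ### The generalized commit-adopt computations -/

theorem gcaCo_eq_some {a : Fin n → Option (CTrace A n)} {k : Fin n} {z : CTrace A n}
    (h : gcaCo a k = some z) : ∃ x, a k = some x ∧
      IsGLB ({x} ∪ {y | (∃ j, a j = some y) ∧ ¬ SeqObject.Trace.Comp {y, x}}) z := by
  rw [gcaCo, Option.map_eq_some_iff] at h
  obtain ⟨x, hx, rfl⟩ := h
  exact ⟨x, hx, isGLB_glb ⟨x, Or.inl rfl⟩⟩

/-- If the two inputs are compatible, their upper bound serves. If not, each input takes part in the
meet formed for the other, so `z` already lies below `y`. -/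
theorem gcaCo_comp {a : Fin n → Option (CTrace A n)} {k j : Fin n} {z w : CTrace A n}
    (hz : gcaCo a k = some z) (hw : gcaCo a j = some w) : SeqObject.Trace.Comp {z, w} := by
  obtain ⟨x, hx, hxz⟩ := gcaCo_eq_some hz
  obtain ⟨y, hy, hyw⟩ := gcaCo_eq_some hw
  have h1 : z ≤ x := hxz.1 (Or.inl rfl)
  have h2 : w ≤ y := hyw.1 (Or.inl rfl)
  by_cases hc : SeqObject.Trace.Comp {y, x}
  · obtain ⟨u, h3, h4⟩ := comp_pair.1 hc
    exact comp_pair.2 ⟨u, h1.trans h4, h2.trans h3⟩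
  · exact comp_pair.2 ⟨y, hxz.1 (Or.inr ⟨⟨j, hy⟩, hc⟩), h2⟩

theorem finite_entries (a : Fin n → Option (CTrace A n)) : {x | ∃ k, a k = some x}.Finite := by
  refine ((Set.finite_range a).preimage (Option.some_injective _).injOn).subset ?_
  rintro x ⟨k, hk⟩
  exact ⟨k, hk⟩

theorem isLUB_gcaCo (a : Fin n → Option (CTrace A n)) :
    IsLUB {x | ∃ k, gcaCo a k = some x} (gcaCandidate a).1 := by
  refine isLUB_lub (finite_entries _) ?_
  rintro x ⟨k, hk⟩ y ⟨j, hj⟩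
  exact gcaCo_comp hk hj

open Classical in
theorem count_gcaCandidate_le {a : Fin n → Option (CTrace A n)} {c : Command n O} {N : ℕ}
    (h : ∀ k x, a k = some x → x.ops.count c ≤ N) : (gcaCandidate a).1.ops.count c ≤ N := by
  refine count_lub_le (finite_entries _) ?_ ?_
  · rintro x ⟨k, hk⟩ y ⟨j, hj⟩
    exact gcaCo_comp hk hj
  · rintro z ⟨k, hk⟩
    obtain ⟨x, hx, hz⟩ := gcaCo_eq_some hk
    have hzx : z ≤ x := hz.1 (Or.inl rfl)
    exact (Multiset.count_le_of_le _ (ops_le hzx)).trans (h k x hx)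

theorem le_gcaCandidate {a : Fin n → Option (CTrace A n)} {y : CTrace A n}
    (hne : ∃ k x, a k = some x) (h : ∀ k x, a k = some x → y ≤ x) : y ≤ (gcaCandidate a).1 := by
  obtain ⟨k, x, hx⟩ := hne
  obtain ⟨z, hz⟩ : ∃ z, gcaCo a k = some z := by rw [gcaCo, hx]; exact ⟨_, rfl⟩
  refine le_trans ?_ ((isLUB_gcaCo a).1 ⟨k, hz⟩)
  obtain ⟨x', hx', hg⟩ := gcaCo_eq_some hz
  refine hg.2 ?_
  rintro w (rfl | ⟨⟨j, hj⟩, -⟩)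
  · exact h k _ hx'
  · exact h j _ hj

/-- An entry survives its meet unchanged only if it lies below all entries incompatible with it,
which is impossible unless there are none. -/
theorem gcaCandidate_snd_iff {a : Fin n → Option (CTrace A n)} :
    (gcaCandidate a).2 = true ↔
      ∀ k x j y, a k = some x → a j = some y → SeqObject.Trace.Comp {y, x} := by
  have h0 : (gcaCandidate a).2 = true ↔ a = gcaCo a := by simp [gcaCandidate]
  rw [h0]
  constructor
  · intro h k x j y hk hj
    by_contra hc
    obtain ⟨x', hx', hg⟩ := gcaCo_eq_some (h ▸ hk : gcaCo a k = some x)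
    obtain rfl : x = x' := by simpa [hk] using hx'
    have hxy : x ≤ y := hg.1 (Or.inr ⟨⟨j, hj⟩, hc⟩)
    exact hc (comp_pair.2 ⟨y, le_rfl, hxy⟩)
  · intro h
    funext k
    cases hk : a k with
    | none => rw [gcaCo, hk]; rfl
    | some x =>
      rw [gcaCo, hk, Option.map_some, glb_eq]
      refine ⟨?_, fun y hy => hy (Or.inl rfl)⟩
      rintro y (rfl | ⟨⟨j, hj⟩, hc⟩)
      · exact le_rfl
      · exact absurd (h k x j y hk hj) hc

theorem isLUB_gcaCandidate {a : Fin n → Option (CTrace A n)} (h : (gcaCandidate a).2 = true) :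
    IsLUB {x | ∃ k, a k = some x} (gcaCandidate a).1 := by
  have h0 : a = gcaCo a := by simpa [gcaCandidate] using h
  have := isLUB_gcaCo a
  rwa [← h0] at this

/-- If all entries of the view equal `s`, then the candidate is `(s, True)`. -/
theorem gcaCandidate_of_forall_eq {a : Fin n → Option (CTrace A n)} {s : CTrace A n}
    (hne : ∃ k, a k = some s) (h : ∀ k x, a k = some x → x = s) :
    gcaCandidate a = (s, true) := by
  have h2 : (gcaCandidate a).2 = true := gcaCandidate_snd_iff.2 fun k x j y hk hj => by
    rw [h k x hk, h j y hj]
    exact comp_pair.2 ⟨s, le_rfl, le_rfl⟩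
  have h1 := isLUB_gcaCandidate h2
  refine Prod.ext (SeqObject.Trace.le_antisymm (h1.2 ?_) (h1.1 hne)) h2
  rintro x ⟨k, hk⟩
  exact (h k x hk).le

theorem gcaOutput_le {b : Fin n → Option (CTrace A n × Bool)} {bi x : CTrace A n} {k : Fin n}
    (h : b k = some (x, true)) : gcaOutput b bi ≤ x := by
  have hne : {x | ∃ k, b k = some (x, true)}.Nonempty := ⟨x, k, h⟩
  rw [gcaOutput, if_pos ⟨k, x, h⟩]
  exact (isGLB_glb hne).1 ⟨k, h⟩

theorem le_gcaOutput {b : Fin n → Option (CTrace A n × Bool)} {bi y : CTrace A n}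
    (h : ∀ k x, b k = some (x, true) → y ≤ x)
    (hbi : (¬ ∃ k x, b k = some (x, true)) → y ≤ bi) : y ≤ gcaOutput b bi := by
  rw [gcaOutput]
  split_ifs with hc
  · obtain ⟨k, x, hk⟩ := hc
    have hne : {x | ∃ k, b k = some (x, true)}.Nonempty := ⟨x, k, hk⟩
    refine (isGLB_glb hne).2 ?_
    rintro z ⟨j, hj⟩
    exact h j z hj
  · exact hbi hc

open Classical in
theorem count_gcaOutput_le {b : Fin n → Option (CTrace A n × Bool)} {bi : CTrace A n}
    {c : Command n O} {N : ℕ} (h : ∀ k x, b k = some (x, true) → x.ops.count c ≤ N)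
    (hbi : bi.ops.count c ≤ N) : (gcaOutput b bi).ops.count c ≤ N := by
  by_cases hc : ∃ k x, b k = some (x, true)
  · obtain ⟨k, x, hk⟩ := hc
    exact (Multiset.count_le_of_le _ (ops_le (gcaOutput_le hk))).trans (h k x hk)
  · rwa [gcaOutput, if_neg hc]

theorem gcaCommits_iff {s β : CTrace A n} {a : Fin n → Option (CTrace A n)}
    {b : Fin n → Option (CTrace A n × Bool)} : gcaCommits s a b β = true ↔
      ((∀ k x, a k = some x → x = s) ∧ (∀ k x c, b k = some (x, c) → x = s)) ∨
      ((∀ k x, a k = some x → x ≤ β → b k ≠ none) ∧ ¬ ∃ k x, b k = some (x, false)) := by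
  simp only [gcaCommits, decide_eq_true_eq]

end GCA

section Executions

open SeqObject.Trace

variable {Q O R : Type*} {A : SeqObject Q O R} {n : ℕ}

/-! ### Single steps -/

namespace Config

theorem update_update_of_ne {α : Type*} (f : ℕ → Fin n → α) (r r' : ℕ) {i j : Fin n} (v : α)
    (h : i ≠ j) : Function.update f r (Function.update (f r) i v) r' j = f r' j := by
  by_cases hr : r' = r
  · subst hr
    rw [Function.update_self, Function.update_of_ne h.symm]
  · rw [Function.update_of_ne hr]

theorem next_of_proc_ne {C : Config A n} {ev : Event n O} {j : Fin n} (h : ev.proc ≠ j) :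
    (C.next ev).loc j = C.loc j ∧ (C.next ev).S j = C.S j ∧
      (∀ r, (C.next ev).snA r j = C.snA r j) ∧ ∀ r, (C.next ev).snB r j = C.snB r j := by
  cases ev with
  | invoke i o =>
    have hi : j ≠ i := fun h' => h h'.symm
    simp [next, Function.update_of_ne hi]
  | step i =>
    have hi : i ≠ j := h
    have hi' : j ≠ i := hi.symm
    simp only [next]
    split <;> try split
    all_goals simp [setPhase, Function.update_of_ne hi', update_update_of_ne _ _ _ _ hi]

theorem pending_eq_none {C : Config A n} {j : Fin n} :
    C.pending j = none ↔ (C.loc j).phase = .idle := by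
  unfold pending
  cases (C.loc j).phase <;> simp [Phase.pending]

theorem S_next (C : Config A n) (ev : Event n O) (j : Fin n) :
    (C.next ev).S j = C.S j ∨ ∃ cmd r s, ev = .step j ∧ (C.loc j).phase = .publish cmd r s ∧
      (C.next ev).S j = (r, s) := by
  by_cases h : ev.proc = j
  · cases ev with
    | invoke i o => exact Or.inl rfl
    | step i =>
      obtain rfl : i = j := h
      cases hp : (C.loc i).phase <;> simp only [next, hp]
      case publish cmd r s => right; exact ⟨cmd, r, s, trivial, by rfl, by simp [setPhase]⟩
      case scan => left; split <;> rfl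
      all_goals exact Or.inl (by trivial)
  · exact Or.inl (next_of_proc_ne h).2.1

theorem snA_next (C : Config A n) (ev : Event n O) (r : ℕ) (j : Fin n) :
    (C.next ev).snA r j = C.snA r j ∨ ∃ cmd s, ev = .step j ∧
      (C.loc j).phase = .writeA cmd r s ∧ (C.next ev).snA r j = some s := by
  by_cases h : ev.proc = j
  · cases ev with
    | invoke i o => exact Or.inl rfl
    | step i =>
      obtain rfl : i = j := h
      cases hp : (C.loc i).phase <;> simp only [next, hp]
      case writeA cmd r' s =>
        by_cases hr : r = r'
        · subst hr
          right
          exact ⟨cmd, s, trivial, by rfl, by simp [setPhase]⟩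
        · left
          simp [setPhase, Function.update_of_ne hr]
      case scan => left; split <;> rfl
      all_goals exact Or.inl (by trivial)
  · exact Or.inl ((next_of_proc_ne h).2.2.1 r)

theorem snB_next (C : Config A n) (ev : Event n O) (r : ℕ) (j : Fin n) :
    (C.next ev).snB r j = C.snB r j ∨ ∃ cmd s a, ev = .step j ∧
      (C.loc j).phase = .writeB cmd r s a ∧ (C.next ev).snB r j = some (gcaCandidate a) := by
  by_cases h : ev.proc = j
  · cases ev with
    | invoke i o => exact Or.inl rfl
    | step i =>
      obtain rfl : i = j := h
      cases hp : (C.loc i).phase <;> simp only [next, hp]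
      case writeB cmd r' s a =>
        by_cases hr : r = r'
        · subst hr
          right
          exact ⟨cmd, s, a, trivial, by rfl, by simp [setPhase]⟩
        · left
          simp [setPhase, Function.update_of_ne hr]
      case scan => left; split <;> rfl
      all_goals exact Or.inl (by trivial)
  · exact Or.inl ((next_of_proc_ne h).2.2.2 r)

/-- The pair kept by a process that holds `(ρ, s)` and reads `S[k]`. -/
noncomputable def scanMax (C : Config A n) (k : Fin n) (ρ : ℕ) (s : CTrace A n) : ℕ × CTrace A n :=
  if ρ < (C.S k).1 then C.S k else (ρ, s)

theorem scanMax_cases (C : Config A n) (k : Fin n) (ρ : ℕ) (s : CTrace A n) :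
    C.scanMax k ρ s = C.S k ∨ C.scanMax k ρ s = (ρ, s) := by
  unfold scanMax
  split_ifs
  · exact Or.inl rfl
  · exact Or.inr rfl

theorem le_scanMax (C : Config A n) (k : Fin n) (ρ : ℕ) (s : CTrace A n) :
    (C.S k).1 ≤ (C.scanMax k ρ s).1 ∧ ρ ≤ (C.scanMax k ρ s).1 := by
  unfold scanMax
  split_ifs with h
  · exact ⟨le_rfl, h.le⟩
  · exact ⟨not_lt.1 h, le_rfl⟩

/-- The next control state of process `i` when it takes a step. -/
noncomputable def nextPhase (C : Config A n) (i : Fin n) : Phase A n :=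
  match (C.loc i).phase with
  | .idle => .idle
  | .scan cmd j r s =>
    if h : j.val + 1 < n then
      .scan cmd ⟨j.val + 1, h⟩ (C.scanMax j r s).1 (C.scanMax j r s).2
    else .loop cmd (C.scanMax j r s).1 (C.scanMax j r s).2 false
  | .writeA cmd r s => .snapA cmd r s
  | .snapA cmd r s => .writeB cmd r s (C.snA r)
  | .writeB cmd r s a => .snapB cmd r s a
  | .snapB cmd r s a =>
    .loop cmd r (gcaOutput (C.snB r) (gcaCandidate a).1)
      (gcaCommits s a (C.snB r) (gcaOutput (C.snB r) (gcaCandidate a).1))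
  | .publish cmd _ s => .respond cmd s
  | .respond _ _ => .idle

theorem phase_next_step (C : Config A n) (i : Fin n) :
    ((C.next (.step i)).loc i).phase = C.nextPhase i := by
  cases hp : (C.loc i).phase <;> simp only [next, nextPhase, hp]
  case scan => split <;> simp [setPhase, scanMax]
  all_goals simp [setPhase]

/-- Process `j` has written nothing to the first snapshot objects of rounds `≥ a`, and nothing to
the second ones of rounds `≥ b`. -/
def Fresh (C : Config A n) (j : Fin n) (a b : ℕ) : Prop :=
  (∀ r ≥ a, C.snA r j = none) ∧ ∀ r ≥ b, C.snB r j = none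

/-- Invariant of the local state and of the shared variables written by process `j`. -/
def LocalInv (C : Config A n) (j : Fin n) : Prop :=
  match (C.loc j).phase with
  | .idle => C.Fresh j ((C.S j).1 + 1) ((C.S j).1 + 1)
  | .scan cmd k ρ _ => cmd.proc = j ∧ C.Fresh j ((C.S j).1 + 1) ((C.S j).1 + 1) ∧
      (j < k → (C.S j).1 ≤ ρ)
  | .writeA cmd r s => cmd.proc = j ∧ cmd ∈ s.ops ∧ (C.S j).1 < r ∧ C.Fresh j r r
  | .snapA cmd r s => cmd.proc = j ∧ cmd ∈ s.ops ∧ (C.S j).1 < r ∧ C.Fresh j (r + 1) r ∧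
      C.snA r j = some s
  | .writeB cmd r s _ => cmd.proc = j ∧ cmd ∈ s.ops ∧ (C.S j).1 < r ∧ C.Fresh j (r + 1) r ∧
      C.snA r j = some s
  | .snapB cmd r s a => cmd.proc = j ∧ cmd ∈ s.ops ∧ (C.S j).1 < r ∧ C.Fresh j (r + 1) (r + 1) ∧
      C.snA r j = some s ∧ C.snB r j = some (gcaCandidate a)
  | .publish cmd r s => cmd.proc = j ∧ cmd ∈ s.ops ∧ (C.S j).1 < r ∧ C.Fresh j (r + 1) (r + 1)
  | .respond cmd _ => cmd.proc = j ∧ cmd ∈ (C.S j).2.ops ∧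
      C.Fresh j ((C.S j).1 + 1) ((C.S j).1 + 1)

/-- Entries are written once: a process about to write in round `r` still has a fresh entry there.
-/
theorem LocalInv.snA_next {C : Config A n} {j : Fin n} (h : C.LocalInv j) {r : ℕ} {x : CTrace A n}
    (hx : C.snA r j = some x) (ev : Event n O) : (C.next ev).snA r j = some x := by
  rcases C.snA_next ev r j with h1 | ⟨cmd, s, -, hp, -⟩
  · rw [h1, hx]
  · simp only [LocalInv, hp] at h
    rw [h.2.2.2.1 r le_rfl] at hx
    cases hx

theorem LocalInv.snB_next {C : Config A n} {j : Fin n} (h : C.LocalInv j) {r : ℕ}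
    {x : CTrace A n × Bool} (hx : C.snB r j = some x) (ev : Event n O) :
    (C.next ev).snB r j = some x := by
  rcases C.snB_next ev r j with h1 | ⟨cmd, s, a, -, hp, -⟩
  · rw [h1, hx]
  · simp only [LocalInv, hp] at h
    rw [h.2.2.2.1.2 r le_rfl] at hx
    cases hx

/-- After the scan, the held round may equal that of the own register, but the flag is then `false`
and the loop continues in the next round. The strict inequality is needed only for leaving the loop.
-/
theorem LocalInv.loop {C : Config A n} {j : Fin n} {cmd : Command n O} {r : ℕ} {s : CTrace A n}
    {c : Bool} (hp : (C.loc j).phase = .loop cmd r s c) (hj : cmd.proc = j)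
    (hf : C.Fresh j (r + 1) (r + 1)) (hr : (C.S j).1 ≤ r) (hc : c = true → (C.S j).1 < r) :
    C.LocalInv j := by
  unfold Phase.loop at hp
  by_cases hcond : cmd ∉ s.ops ∨ c = false
  · rw [if_pos hcond] at hp
    simp only [LocalInv, hp]
    refine ⟨hj, ?_, by omega, hf⟩
    by_cases hm : cmd ∈ s.ops
    · simp [hm]
    · simp only [hm, not_false_eq_true, if_true, mem_ops_mul]
      exact Or.inr (by simp [ops_mk])
  · rw [if_neg hcond] at hp
    simp only [LocalInv, hp]
    push Not at hcond
    exact ⟨hj, hcond.1, hc (by simpa using hcond.2), hf⟩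

theorem LocalInv.next {C : Config A n} {j : Fin n} (h : C.LocalInv j) {ev : Event n O}
    (hE : C.Enabled ev) : (C.next ev).LocalInv j := by
  by_cases hj : ev.proc = j
  · cases ev with
    | invoke i o =>
      obtain rfl : i = j := hj
      have hp : (C.loc i).phase = .idle := pending_eq_none.1 hE
      simp only [LocalInv, hp] at h
      simp only [LocalInv, Config.next, Function.update_self]
      refine ⟨trivial, h, fun hlt => ?_⟩
      simp [Fin.lt_def] at hlt
    | step i =>
      obtain rfl : i = j := hj
      have hph := C.phase_next_step i
      have hS := C.S_next (.step i) i
      have hA := fun r => C.snA_next (.step i) r i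
      have hB := fun r => C.snB_next (.step i) r i
      cases hp : (C.loc i).phase with
      | idle => exact absurd (pending_eq_none.2 hp) hE
      | scan cmd k ρ s =>
        simp only [LocalInv, hp] at h
        obtain ⟨hcmd, hf, hk⟩ := h
        simp only [nextPhase, hp] at hph
        simp only [hp, reduceCtorEq, and_false, false_and, exists_false, or_false] at hS hA hB
        have hf' : ∀ a b, C.Fresh i a b → (C.next (.step i)).Fresh i a b := fun a b hab =>
          ⟨fun r hr => (hA r).trans (hab.1 r hr), fun r hr => (hB r).trans (hab.2 r hr)⟩
        -- Once the scan has read the own register, the held round dominates it; this is what makes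
        -- the next round fresh for the process.
        have hm : i ≤ k → (C.S i).1 ≤ (C.scanMax k ρ s).1 := by
          intro hik
          have hle := C.le_scanMax k ρ s
          rcases hik.lt_or_eq with hlt | rfl
          · exact (hk hlt).trans hle.2
          · exact hle.1
        split_ifs at hph with hn
        · simp only [LocalInv, hph, hS]
          refine ⟨hcmd, hf' _ _ hf, fun hlt => hm ?_⟩
          simp only [Fin.lt_def, Fin.le_def] at hlt ⊢
          omega
        · have hle := hm (by simp only [Fin.le_def]; have := i.2; omega)
          refine LocalInv.loop hph hcmd (hf' _ _ ?_) (by rw [hS]; exact hle) (by simp)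
          exact ⟨fun r hr => hf.1 r (by omega), fun r hr => hf.2 r (by omega)⟩
      | writeA cmd r s =>
        simp only [LocalInv, hp] at h
        obtain ⟨hcmd, hm, hr, hf⟩ := h
        simp only [nextPhase, hp] at hph
        simp only [LocalInv, hph]
        simp only [Config.next, hp, setPhase, Fresh, Function.update_self]
        refine ⟨hcmd, hm, hr, ⟨fun r' hr' => ?_, hf.2⟩, trivial⟩
        rw [Function.update_of_ne (by omega)]
        exact hf.1 r' (by omega)
      | snapA cmd r s =>
        simp only [LocalInv, hp] at h
        simp only [nextPhase, hp] at hph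
        simp only [LocalInv, hph]
        simpa only [Config.next, hp, setPhase, Fresh] using h
      | writeB cmd r s a =>
        simp only [LocalInv, hp] at h
        obtain ⟨hcmd, hm, hr, hf, hx⟩ := h
        simp only [nextPhase, hp] at hph
        simp only [LocalInv, hph]
        simp only [Config.next, hp, setPhase, Fresh, Function.update_self]
        refine ⟨hcmd, hm, hr, ⟨hf.1, fun r' hr' => ?_⟩, hx, trivial⟩
        rw [Function.update_of_ne (by omega)]
        exact hf.2 r' (by omega)
      | snapB cmd r s a =>
        simp only [LocalInv, hp] at h
        obtain ⟨hcmd, hm, hr, hf, hx⟩ := h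
        simp only [nextPhase, hp] at hph
        simp only [hp, reduceCtorEq, and_false, false_and, exists_false, or_false] at hS hA hB
        refine LocalInv.loop hph hcmd ⟨fun r hr => (hA r).trans (hf.1 r hr),
          fun r hr => (hB r).trans (hf.2 r hr)⟩ (by rw [hS]; omega) (fun _ => by rw [hS]; omega)
      | publish cmd r s =>
        simp only [LocalInv, hp] at h
        obtain ⟨hcmd, hm, hr, hf⟩ := h
        simp only [nextPhase, hp] at hph
        simp only [LocalInv, hph]
        simp only [Config.next, hp, setPhase, Fresh, Function.update_self]
        exact ⟨hcmd, hm, hf⟩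
      | respond cmd s =>
        simp only [LocalInv, hp] at h
        simp only [nextPhase, hp] at hph
        simp only [LocalInv, hph]
        simpa only [Config.next, hp, Fresh] using h.2.2
  · obtain ⟨h1, h2, h3, h4⟩ := next_of_proc_ne (C := C) hj
    simpa only [LocalInv, Fresh, h1, h2, h3, h4] using h

end Config

/-! ### Executions -/

theorem Phase.loop_cases (cmd : Command n O) (r : ℕ) (s : CTrace A n) (c : Bool) :
    (Phase.loop cmd r s c = .writeA cmd (r + 1) s ∧ cmd ∈ s.ops) ∨
    (Phase.loop cmd r s c = .writeA cmd (r + 1) (s * SeqObject.Trace.mk [cmd]) ∧ cmd ∉ s.ops) ∨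
    (Phase.loop cmd r s c = .publish cmd r s ∧ c = true) := by
  unfold Phase.loop
  by_cases hm : cmd ∈ s.ops
  · cases c <;> simp [hm]
  · simp [hm]

theorem IsInfiniteExecution.localInv {e : ℕ → Event n O} (he : IsInfiniteExecution A e) (t : ℕ)
    (j : Fin n) : (configAt A e t).LocalInv j := by
  induction t with
  | zero => simp [configAt, Config.LocalInv, Config.init, Config.Fresh]
  | succ t ih => exact ih.next (he t)

theorem IsInfiniteExecution.snA_mono {e : ℕ → Event n O} (he : IsInfiniteExecution A e) {t t' : ℕ}
    (h : t ≤ t') {r : ℕ} {j : Fin n} {x : CTrace A n} (hx : (configAt A e t).snA r j = some x) :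
    (configAt A e t').snA r j = some x := by
  induction t', h using Nat.le_induction with
  | base => exact hx
  | succ t' _ ih => exact (he.localInv t' j).snA_next ih _

theorem IsInfiniteExecution.snB_mono {e : ℕ → Event n O} (he : IsInfiniteExecution A e) {t t' : ℕ}
    (h : t ≤ t') {r : ℕ} {j : Fin n} {x : CTrace A n × Bool}
    (hx : (configAt A e t).snB r j = some x) : (configAt A e t').snB r j = some x := by
  induction t', h using Nat.le_induction with
  | base => exact hx
  | succ t' _ ih => exact (he.localInv t' j).snB_next ih _

theorem IsInfiniteExecution.snB_unique {e : ℕ → Event n O} (he : IsInfiniteExecution A e)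
    {t t' : ℕ} {r : ℕ} {j : Fin n} {x y : CTrace A n × Bool}
    (hx : (configAt A e t).snB r j = some x) (hy : (configAt A e t').snB r j = some y) : x = y := by
  have h1 := he.snB_mono (le_max_left t t') hx
  have h2 := he.snB_mono (le_max_right t t') hy
  exact Option.some_injective _ (h1.symm.trans h2)

theorem IsInfiniteExecution.snA_unique {e : ℕ → Event n O} (he : IsInfiniteExecution A e)
    {t t' : ℕ} {r : ℕ} {j : Fin n} {x y : CTrace A n}
    (hx : (configAt A e t).snA r j = some x) (hy : (configAt A e t').snA r j = some y) : x = y := by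
  have h1 := he.snA_mono (le_max_left t t') hx
  have h2 := he.snA_mono (le_max_right t t') hy
  exact Option.some_injective _ (h1.symm.trans h2)

theorem IsInfiniteExecution.phase_succ {e : ℕ → Event n O} (he : IsInfiniteExecution A e) (t : ℕ)
    (j : Fin n) :
    ((e t).proc ≠ j ∧ ((configAt A e (t + 1)).loc j).phase = ((configAt A e t).loc j).phase) ∨
    (e t = .step j ∧ ((configAt A e (t + 1)).loc j).phase = (configAt A e t).nextPhase j) ∨
    (∃ o cmd k, e t = .invoke j o ∧ ((configAt A e t).loc j).phase = .idle ∧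
      ((configAt A e (t + 1)).loc j).phase = .scan cmd k 0 1) := by
  by_cases h : (e t).proc = j
  · right
    cases het : e t with
    | step i =>
      obtain rfl : i = j := by rw [het] at h; exact h
      left
      refine ⟨rfl, ?_⟩
      rw [configAt, het, Config.phase_next_step]
    | invoke i o =>
      obtain rfl : i = j := by rw [het] at h; exact h
      right
      have h0 := he t
      rw [het] at h0
      refine ⟨o, ⟨o, i, ((configAt A e t).loc i).seq + 1⟩, ⟨0, i.pos⟩, rfl,
        Config.pending_eq_none.1 h0, ?_⟩
      rw [configAt, het]
      simp only [Config.next, Function.update_self]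
  · left
    refine ⟨h, ?_⟩
    rw [configAt, (Config.next_of_proc_ne h).1]

/-- The view of the first snapshot object held by a process was taken earlier. -/
theorem IsInfiniteExecution.exists_view {e : ℕ → Event n O} (he : IsInfiniteExecution A e) (t : ℕ)
    {j : Fin n} {cmd : Command n O} {r : ℕ} {s : CTrace A n} {a : Fin n → Option (CTrace A n)}
    (h : ((configAt A e t).loc j).phase = .writeB cmd r s a ∨
      ((configAt A e t).loc j).phase = .snapB cmd r s a) :
    ∃ u < t, a = (configAt A e u).snA r ∧ (configAt A e u).snA r j = some s := by
  induction t with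
  | zero => simp [configAt, Config.init] at h
  | succ t ih =>
    rcases he.phase_succ t j with ⟨-, h1⟩ | ⟨-, h1⟩ | ⟨_, _, _, -, -, h1⟩
    · rw [h1] at h
      obtain ⟨u, hu, h2⟩ := ih h
      exact ⟨u, by omega, h2⟩
    · rw [h1] at h
      have hL := he.localInv t j
      cases hp : ((configAt A e t).loc j).phase <;> simp only [Config.nextPhase, hp] at h
      case scan cmd' k ρ s' =>
        split_ifs at h
        · simp at h
        · rcases Phase.loop_cases cmd' ((configAt A e t).scanMax k ρ s').1
            ((configAt A e t).scanMax k ρ s').2 false with ⟨h2, -⟩ | ⟨h2, -⟩ | ⟨h2, -⟩ <;>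
          simp [h2] at h
      case snapA =>
        simp only [Config.LocalInv, hp] at hL
        simp at h
        obtain ⟨rfl, rfl, rfl, rfl⟩ := h
        exact ⟨t, by omega, rfl, hL.2.2.2.2⟩
      case writeB =>
        simp at h
        obtain ⟨rfl, rfl, rfl, rfl⟩ := h
        obtain ⟨u, hu, h2⟩ := ih (Or.inl hp)
        exact ⟨u, by omega, h2⟩
      case snapB cmd' r' s' a' =>
        rcases Phase.loop_cases cmd' r' (gcaOutput ((configAt A e t).snB r') (gcaCandidate a').1)
          (gcaCommits s' a' ((configAt A e t).snB r')
            (gcaOutput ((configAt A e t).snB r') (gcaCandidate a').1))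
          with ⟨h2, -⟩ | ⟨h2, -⟩ | ⟨h2, -⟩ <;> simp [h2] at h
      all_goals simp at h
    · simp [h1] at h

/-- Traces each entry of `B` back to the time of the snapshot it was computed from. The owner's
proposal is visible in that snapshot, since it was written before. -/
theorem IsInfiniteExecution.snB_eq_some {e : ℕ → Event n O} (he : IsInfiniteExecution A e)
    (t : ℕ) {k : Fin n} {r : ℕ} {p : CTrace A n × Bool}
    (h : (configAt A e t).snB r k = some p) :
    ∃ u < t, p = gcaCandidate ((configAt A e u).snA r) ∧
      ∃ x, (configAt A e u).snA r k = some x := by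
  induction t with
  | zero => simp [configAt, Config.init] at h
  | succ t ih =>
    rcases (configAt A e t).snB_next (e t) r k with h1 | ⟨cmd, s, a, -, hp, h1⟩
    · rw [configAt, h1] at h
      obtain ⟨u, hu, h2⟩ := ih h
      exact ⟨u, by omega, h2⟩
    · rw [configAt, h1] at h
      obtain ⟨u, hu, rfl, h2⟩ := he.exists_view t (Or.inl hp)
      exact ⟨u, by omega, (Option.some_injective _ h).symm, s, h2⟩

/-! ### Outputs of a round: commitment, agreement and validity. -/

variable (A) in
/-- At time `t`, process `j` returns `β` with flag `c` from its proposal in round `r`. -/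
def IsOutput (e : ℕ → Event n O) (t : ℕ) (j : Fin n) (r : ℕ) (β : CTrace A n) (c : Bool) : Prop :=
  ∃ cmd s a, ((configAt A e t).loc j).phase = .snapB cmd r s a ∧ e t = .step j ∧
    β = gcaOutput ((configAt A e t).snB r) (gcaCandidate a).1 ∧
    c = gcaCommits s a ((configAt A e t).snB r) β

theorem IsInfiniteExecution.output_data {e : ℕ → Event n O} (he : IsInfiniteExecution A e)
    {t : ℕ} {j : Fin n} {r : ℕ} {β : CTrace A n} {c : Bool} (h : IsOutput A e t j r β c) :
    ∃ u < t, ∃ s, (configAt A e u).snA r j = some s ∧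
      (configAt A e t).snB r j = some (gcaCandidate ((configAt A e u).snA r)) ∧
      β = gcaOutput ((configAt A e t).snB r) (gcaCandidate ((configAt A e u).snA r)).1 ∧
      c = gcaCommits s ((configAt A e u).snA r) ((configAt A e t).snB r) β := by
  obtain ⟨cmd, s, a, hp, -, hβ, hc⟩ := h
  have hL := he.localInv t j
  simp only [Config.LocalInv, hp] at hL
  obtain ⟨u, hu, rfl, h2⟩ := he.exists_view t (Or.inr hp)
  exact ⟨u, hu, s, h2, hL.2.2.2.2.2, hβ, hc⟩

theorem IsInfiniteExecution.exists_output_of_publish {e : ℕ → Event n O}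
    (he : IsInfiniteExecution A e) (t : ℕ) {j : Fin n} {cmd : Command n O} {r : ℕ}
    {s : CTrace A n} (h : ((configAt A e t).loc j).phase = .publish cmd r s) :
    ∃ u < t, IsOutput A e u j r s true := by
  induction t with
  | zero => simp [configAt, Config.init] at h
  | succ t ih =>
    rcases he.phase_succ t j with ⟨-, h1⟩ | ⟨het, h1⟩ | ⟨_, _, _, -, -, h1⟩
    · rw [h1] at h
      obtain ⟨u, hu, h2⟩ := ih h
      exact ⟨u, by omega, h2⟩
    · rw [h1] at h
      cases hp : ((configAt A e t).loc j).phase <;> simp only [Config.nextPhase, hp] at h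
      case scan cmd' k ρ s' =>
        split_ifs at h
        rcases Phase.loop_cases cmd' ((configAt A e t).scanMax k ρ s').1
            ((configAt A e t).scanMax k ρ s').2 false with ⟨h2, -⟩ | ⟨h2, -⟩ | ⟨h2, h3⟩
        · simp [h2] at h
        · simp [h2] at h
        · simp at h3
      case snapB cmd' r' s' a' =>
        rcases Phase.loop_cases cmd' r' (gcaOutput ((configAt A e t).snB r') (gcaCandidate a').1)
          (gcaCommits s' a' ((configAt A e t).snB r')
            (gcaOutput ((configAt A e t).snB r') (gcaCandidate a').1))
          with ⟨h2, -⟩ | ⟨h2, -⟩ | ⟨h2, h3⟩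
        · simp [h2] at h
        · simp [h2] at h
        · rw [h2] at h
          simp only [Phase.publish.injEq] at h
          obtain ⟨rfl, rfl, rfl⟩ := h
          exact ⟨t, by omega, _, _, _, hp, het, rfl, h3.symm⟩
      all_goals simp at h
    · simp [h1] at h

/-- The loop is left only with flag `true`, so a stored trace other than the initial one was
committed; this makes agreement applicable to registers. -/
theorem IsInfiniteExecution.S_eq {e : ℕ → Event n O} (he : IsInfiniteExecution A e) (t : ℕ)
    (j : Fin n) : (configAt A e t).S j = (0, 1) ∨
      ∃ u < t, IsOutput A e u j ((configAt A e t).S j).1 ((configAt A e t).S j).2 true := by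
  induction t with
  | zero => exact Or.inl rfl
  | succ t ih =>
    rcases (configAt A e t).S_next (e t) j with h1 | ⟨cmd, r, s, -, hp, h1⟩
    · rw [configAt, h1]
      rcases ih with ih | ⟨u, hu, ih⟩
      · exact Or.inl ih
      · exact Or.inr ⟨u, by omega, ih⟩
    · rw [configAt, h1]
      obtain ⟨u, hu, h2⟩ := he.exists_output_of_publish t hp
      exact Or.inr ⟨u, by omega, h2⟩

/-- Later snapshots contain earlier ones, and a flagged candidate is the join of its whole snapshot.
Hence the flagged candidates of a round form a chain, ordered by snapshot time. -/
theorem IsInfiniteExecution.gcaCandidate_mono {e : ℕ → Event n O} (he : IsInfiniteExecution A e)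
    {u u' : ℕ} (h : u ≤ u') {r : ℕ} (h1 : (gcaCandidate ((configAt A e u).snA r)).2 = true)
    (h2 : (gcaCandidate ((configAt A e u').snA r)).2 = true) :
    (gcaCandidate ((configAt A e u).snA r)).1 ≤ (gcaCandidate ((configAt A e u').snA r)).1 := by
  refine (isLUB_gcaCandidate h1).2 ?_
  rintro x ⟨k, hk⟩
  exact (isLUB_gcaCandidate h2).1 ⟨k, he.snA_mono h hk⟩

/-- Agreement: every output of a round extends every committed one. -/
theorem IsInfiniteExecution.agreement {e : ℕ → Event n O} (he : IsInfiniteExecution A e)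
    {t t' : ℕ} {p q : Fin n} {r : ℕ} {β β' : CTrace A n} {c : Bool}
    (hp : IsOutput A e t p r β true) (hq : IsOutput A e t' q r β' c) : β ≤ β' := by
  obtain ⟨u, hu, s, hs, hB, hβ, hc⟩ := he.output_data hp
  obtain ⟨u', hu', s', hs', hB', hβ', -⟩ := he.output_data hq
  have hβle : ∀ k x, (configAt A e t).snB r k = some (x, true) → β ≤ x := fun k x hk =>
    hβ.le.trans (gcaOutput_le hk)
  rw [hβ']
  rcases gcaCommits_iff.1 hc.symm with ⟨hA1, hB1⟩ | ⟨hA2, hB2⟩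
  -- First commit rule: only `s` was seen, so `β ≤ s`. A flagged candidate from a snapshot before
  -- `u` is `s` itself, and one from a later snapshot contains the proposal `s` of `p`.
  · have hcand := gcaCandidate_of_forall_eq ⟨p, hs⟩ hA1
    rw [hcand] at hB
    refine (hβle p s hB).trans (le_gcaOutput (fun k x hk => ?_) fun hne => ?_)
    · obtain ⟨w, hw, hx, y, hy⟩ := he.snB_eq_some t' hk
      rcases le_total w u with h | h
      · have hy' := hA1 k y (he.snA_mono h hy)
        subst hy'
        rw [gcaCandidate_of_forall_eq ⟨k, hy⟩ fun j z hz => hA1 j z (he.snA_mono h hz)] at hx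
        exact (Prod.ext_iff.1 hx).1.ge
      · have hx2 := (Prod.ext_iff.1 hx).2
        have hx1 : x = _ := (Prod.ext_iff.1 hx).1
        rw [hx1]
        exact (isLUB_gcaCandidate hx2.symm).1 ⟨p, he.snA_mono h hs⟩
    · rcases le_total t t' with h | h
      · exact absurd ⟨p, s, he.snB_mono h hB⟩ hne
      · exact (hB1 q _ _ (he.snB_mono h hB')).ge
  -- Second commit rule: every candidate seen by `p` is flagged, so those seen are compared through
  -- the times of their snapshots.
  · push Not at hB2
    have htrue : ∀ k x, (configAt A e t).snB r k = some x → x = (x.1, true) := by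
      rintro k ⟨x, b⟩ hk
      cases b
      · exact absurd hk (hB2 k x)
      · rfl
    refine le_gcaOutput (fun k x hk => ?_) fun hne => ?_
    · cases hkt : (configAt A e t).snB r k with
      | some y =>
        rw [he.snB_unique hkt hk] at hkt
        exact hβle k x hkt
      | none =>
        obtain ⟨w, hw, hx, y, hy⟩ := he.snB_eq_some t' hk
        have hx2 := ((Prod.ext_iff.1 hx).2).symm
        have hx1 : x = _ := (Prod.ext_iff.1 hx).1
        have hBp := htrue p _ hB
        -- The entry of `k` was not seen by `p`. If `p` saw a candidate from a snapshot no later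
        -- than that of `k`, then `β` lies below it, hence below the candidate of `k`.
        by_cases hex : ∃ m z v, (configAt A e t).snB r m = some z ∧ v ≤ w ∧
            z = gcaCandidate ((configAt A e v).snA r)
        · obtain ⟨m, z, v, hz, hv, hzv⟩ := hex
          have hz' := htrue m z hz
          rw [hx1]
          refine (hβle m z.1 (hz' ▸ hz)).trans ?_
          rw [hzv]
          refine he.gcaCandidate_mono hv ?_ hx2
          rw [← hzv, hz']
        -- Otherwise the snapshot of `k` precedes all those behind the candidates seen by `p`. They
        -- all contain the proposal `y` of `k`, so `y ≤ β`, and the commit rule demands that the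
        -- entry of `k` was seen.
        · push Not at hex
          have hwu : w ≤ u := by
            by_contra hlt
            exact hex p _ u hB (by omega) rfl
          refine absurd hkt (hA2 k y (he.snA_mono hwu hy) ?_)
          have hle : ∀ m z, (configAt A e t).snB r m = some (z, true) → y ≤ z := by
            intro m z hz
            obtain ⟨v, -, hv, -⟩ := he.snB_eq_some t hz
            have hwv : w ≤ v := by
              by_contra hlt
              exact hex m _ v hz (by omega) hv
            have hv1 : z = _ := (Prod.ext_iff.1 hv).1
            rw [hv1]
            exact (isLUB_gcaCandidate (Prod.ext_iff.1 hv).2.symm).1 ⟨k, he.snA_mono hwv hy⟩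
          rw [hβ]
          exact le_gcaOutput hle fun hne => absurd ⟨p, _, hB.trans (congrArg some hBp)⟩ hne
    · rcases le_total t t' with h | h
      · exact absurd ⟨p, _, (he.snB_mono h hB).trans (congrArg some (htrue p _ hB))⟩ hne
      · exact absurd ⟨q, _, hB'.trans (congrArg some (htrue q _ (he.snB_mono h hB')))⟩ hne

-- Joins and meets never raise a multiplicity above that of the inputs. The case `N = 0` says that
-- no unproposed command appears in an output, the case `N = 1` that none is duplicated.
open Classical in
theorem IsInfiniteExecution.count_output_le {e : ℕ → Event n O} (he : IsInfiniteExecution A e)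
    {t : ℕ} {j : Fin n} {r : ℕ} {β : CTrace A n} {c : Bool} (h : IsOutput A e t j r β c)
    {o : Command n O} {N : ℕ}
    (hN : ∀ k x, (configAt A e t).snA r k = some x → x.ops.count o ≤ N) : β.ops.count o ≤ N := by
  obtain ⟨u, hu, s, -, -, rfl, -⟩ := he.output_data h
  refine count_gcaOutput_le (fun k x hk => ?_)
    (count_gcaCandidate_le fun k x hk => hN k x (he.snA_mono hu.le hk))
  obtain ⟨w, hw, hx, -⟩ := he.snB_eq_some t hk
  have hx1 : x = _ := (Prod.ext_iff.1 hx).1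
  rw [hx1]
  exact count_gcaCandidate_le fun k x hk => hN k x (he.snA_mono hw.le hk)

/-- Every candidate is a join of meets of proposals, so a common lower bound of the proposals passes
to candidates and then to outputs. -/
theorem IsInfiniteExecution.le_output {e : ℕ → Event n O} (he : IsInfiniteExecution A e)
    {t : ℕ} {j : Fin n} {r : ℕ} {β : CTrace A n} {c : Bool} (h : IsOutput A e t j r β c)
    {y : CTrace A n} (hy : ∀ k x, (configAt A e t).snA r k = some x → y ≤ x) : y ≤ β := by
  obtain ⟨u, hu, s, hs, -, rfl, -⟩ := he.output_data h
  refine le_gcaOutput (fun k x hk => ?_)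
    (fun _ => le_gcaCandidate ⟨j, s, hs⟩ fun k x hk => hy k x (he.snA_mono hu.le hk))
  obtain ⟨w, hw, hx, z, hz⟩ := he.snB_eq_some t hk
  have hx1 : x = _ := (Prod.ext_iff.1 hx).1
  rw [hx1]
  exact le_gcaCandidate ⟨k, z, hz⟩ fun k x hk => hy k x (he.snA_mono hw.le hk)

theorem IsInfiniteExecution.mem_output {e : ℕ → Event n O} (he : IsInfiniteExecution A e)
    {t : ℕ} {j : Fin n} {r : ℕ} {β : CTrace A n} {c : Bool} (h : IsOutput A e t j r β c)
    {o : Command n O} (ho : o ∈ β.ops) :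
    ∃ k x, (configAt A e t).snA r k = some x ∧ o ∈ x.ops := by
  classical
  by_contra hne
  push Not at hne
  have := he.count_output_le h (o := o) (N := 0) fun k x hk =>
    (Multiset.count_eq_zero.2 (hne k x hk)).le
  exact Multiset.count_eq_zero.1 (Nat.le_zero.1 this) ho

/-! ### The traces of each round -/

/-- In `C`, the trace `x` is the outcome of round `ρ`, possibly extended by new commands: it is
stored with round `ρ`, held by a process with current round `ρ`, or proposed in round `ρ + 1`. -/
def IsValue (C : Config A n) (ρ : ℕ) (x : CTrace A n) : Prop :=
  (∃ j, C.S j = (ρ, x)) ∨ (∃ j cmd k, (C.loc j).phase = .scan cmd k ρ x) ∨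
    (∃ j cmd, (C.loc j).phase = .publish cmd ρ x) ∨
    (∃ j cmd, (C.loc j).phase = .writeA cmd (ρ + 1) x) ∨ ∃ k, C.snA (ρ + 1) k = some x

theorem Phase.pending_loop (cmd : Command n O) (r : ℕ) (s : CTrace A n) (c : Bool) :
    (Phase.loop cmd r s c).pending = some cmd := by
  rcases Phase.loop_cases cmd r s c with ⟨h, -⟩ | ⟨h, -⟩ | ⟨h, -⟩ <;> rw [h] <;> rfl

/-- Traces are otherwise only copied between registers, control states and proposals: new ones arise
from a fresh scan, from appending a pending command, or as an output. `P` depends on time because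
some invariants speak of the current configuration. -/
theorem IsInfiniteExecution.value_induction {e : ℕ → Event n O} (he : IsInfiniteExecution A e)
    (P : ℕ → ℕ → CTrace A n → Prop) (m : ℕ)
    (hbase : ∀ ρ x, IsValue (configAt A e m) ρ x → P m ρ x)
    (hzero : ∀ t ≥ m, P t 0 1)
    (hmono : ∀ t ≥ m, ∀ ρ x, P t ρ x → P (t + 1) ρ x)
    (happ : ∀ t ≥ m, ∀ j cmd ρ x, e t = .step j → (configAt A e t).pending j = some cmd →
      cmd ∉ x.ops → P t ρ x → P t ρ (x * SeqObject.Trace.mk [cmd]))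
    (hout : ∀ t ≥ m, ∀ j r β c, IsOutput A e t j (r + 1) β c →
      (∀ k x, (configAt A e t).snA (r + 1) k = some x → P t r x) → P t (r + 1) β)
    {t : ℕ} (ht : m ≤ t) {ρ : ℕ} {x : CTrace A n} (hx : IsValue (configAt A e t) ρ x) :
    P t ρ x := by
  induction t, ht using Nat.le_induction generalizing ρ x with
  | base => exact hbase ρ x hx
  | succ t ht ih =>
    refine hmono t ht ρ x ?_
    have loop : ∀ j cmd r s c, e t = .step j → (configAt A e t).pending j = some cmd → P t r s →
        ((∃ cmd' k, Phase.loop cmd r s c = .scan cmd' k ρ x) ∨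
          (∃ cmd', Phase.loop cmd r s c = .publish cmd' ρ x) ∨
          ∃ cmd', Phase.loop cmd r s c = .writeA cmd' (ρ + 1) x) → P t ρ x := by
      intro j cmd r s c het hpend hP h
      rcases Phase.loop_cases cmd r s c with ⟨h1, -⟩ | ⟨h1, hm⟩ | ⟨h1, -⟩ <;> rw [h1] at h <;>
        simp at h
      · obtain ⟨rfl, rfl⟩ := h
        exact hP
      · obtain ⟨rfl, rfl⟩ := h
        exact happ t ht j cmd r s het hpend hm hP
      · obtain ⟨rfl, rfl⟩ := h
        exact hP
    have phase : ∀ j, ((∃ cmd k, ((configAt A e (t + 1)).loc j).phase = .scan cmd k ρ x) ∨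
          (∃ cmd, ((configAt A e (t + 1)).loc j).phase = .publish cmd ρ x) ∨
          ∃ cmd, ((configAt A e (t + 1)).loc j).phase = .writeA cmd (ρ + 1) x) → P t ρ x := by
      intro j h
      rcases he.phase_succ t j with ⟨-, h1⟩ | ⟨het, h1⟩ | ⟨_, cmd, k, -, -, h1⟩ <;> rw [h1] at h
      · rcases h with ⟨cmd, k, h⟩ | ⟨cmd, h⟩ | ⟨cmd, h⟩
        · exact ih (Or.inr (Or.inl ⟨j, cmd, k, h⟩))
        · exact ih (Or.inr (Or.inr (Or.inl ⟨j, cmd, h⟩)))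
        · exact ih (Or.inr (Or.inr (Or.inr (Or.inl ⟨j, cmd, h⟩))))
      · have hL := he.localInv t j
        cases hp : ((configAt A e t).loc j).phase <;> simp only [Config.nextPhase, hp] at h
        case scan cmd' k ρ' s' =>
          have hpend : (configAt A e t).pending j = some cmd' := by
            rw [Config.pending, hp]; rfl
          have hval : P t ((configAt A e t).scanMax k ρ' s').1
              ((configAt A e t).scanMax k ρ' s').2 := by
            rcases (configAt A e t).scanMax_cases k ρ' s' with h2 | h2 <;> rw [h2]
            · exact ih (Or.inl ⟨k, rfl⟩)
            · exact ih (Or.inr (Or.inl ⟨j, cmd', k, hp⟩))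
          split_ifs at h
          · simp at h
            obtain ⟨rfl, rfl⟩ := h
            exact hval
          · exact loop j _ _ _ _ het hpend hval h
        case snapB cmd' r s a =>
          have hpend : (configAt A e t).pending j = some cmd' := by
            rw [Config.pending, hp]; rfl
          simp only [Config.LocalInv, hp] at hL
          -- Proposals are made only in rounds above that of the own register, hence in positive
          -- rounds, and the proposals of round `r + 1` count as values of round `r`.
          obtain ⟨r, rfl⟩ : ∃ r', r = r' + 1 := ⟨r - 1, by omega⟩
          refine loop j _ _ _ _ het hpend ?_ h
          exact hout t ht j r _ _ ⟨cmd', s, a, hp, het, rfl, rfl⟩ fun k x hk =>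
            ih (Or.inr (Or.inr (Or.inr (Or.inr ⟨k, hk⟩))))
        all_goals simp at h
      · simp at h
        obtain ⟨rfl, rfl⟩ := h
        exact hzero t ht
    rcases hx with ⟨j, h⟩ | ⟨j, cmd, k, h⟩ | ⟨j, cmd, h⟩ | ⟨j, cmd, h⟩ | ⟨k, h⟩
    · rcases (configAt A e t).S_next (e t) j with h1 | ⟨cmd, r, s, -, hp, h1⟩
      · rw [configAt, h1] at h
        exact ih (Or.inl ⟨j, h⟩)
      · rw [configAt, h1] at h
        obtain ⟨rfl, rfl⟩ := Prod.ext_iff.1 h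
        exact ih (Or.inr (Or.inr (Or.inl ⟨j, cmd, hp⟩)))
    · exact phase j (Or.inl ⟨cmd, k, h⟩)
    · exact phase j (Or.inr (Or.inl ⟨cmd, h⟩))
    · exact phase j (Or.inr (Or.inr ⟨cmd, h⟩))
    · rcases (configAt A e t).snA_next (e t) (ρ + 1) k with h1 | ⟨cmd, s, -, hp, h1⟩
      · rw [configAt, h1] at h
        exact ih (Or.inr (Or.inr (Or.inr (Or.inr ⟨k, h⟩))))
      · rw [configAt, h1] at h
        obtain rfl := Option.some_injective _ h
        exact ih (Or.inr (Or.inr (Or.inr (Or.inl ⟨k, cmd, hp⟩))))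

theorem isValue_init {e : ℕ → Event n O} {ρ : ℕ} {x : CTrace A n}
    (h : IsValue (configAt A e 0) ρ x) : ρ = 0 ∧ x = 1 := by
  have h' : 0 = ρ ∧ n ≠ 0 ∧ 1 = x := by
    simpa [IsValue, configAt, Config.init, Prod.ext_iff, ← Fin.pos_iff_nonempty,
      Nat.pos_iff_ne_zero] using h
  exact ⟨h'.1.symm, h'.2.2.symm⟩

theorem IsInfiniteExecution.nodup {e : ℕ → Event n O} (he : IsInfiniteExecution A e) {t ρ : ℕ}
    {x : CTrace A n} (hx : IsValue (configAt A e t) ρ x) : x.ops.Nodup := by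
  classical
  refine he.value_induction (fun _ _ x => x.ops.Nodup) 0 ?_ ?_ ?_ ?_ ?_ (Nat.zero_le t) hx
  · intro ρ x h
    rw [(isValue_init h).2]
    exact Multiset.nodup_zero
  · exact fun _ _ => Multiset.nodup_zero
  · exact fun _ _ _ _ h => h
  · intro t _ j cmd ρ x _ _ hm hx
    rw [ops_mul, ops_mk, add_comm, Multiset.coe_singleton, Multiset.singleton_add,
      Multiset.nodup_cons]
    exact ⟨hm, hx⟩
  · intro t _ j r β c ho h
    rw [Multiset.nodup_iff_count_le_one]
    exact fun o => he.count_output_le ho fun k x hk => Multiset.nodup_iff_count_le_one.1 (h k x hk) o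

/-- If all outputs of a round extend `s`, then so do all later traces. -/
theorem IsInfiniteExecution.le_value {e : ℕ → Event n O} (he : IsInfiniteExecution A e) {r : ℕ}
    {s : CTrace A n} (hr : 1 ≤ r) (hs : ∀ t j β c, IsOutput A e t j r β c → s ≤ β) {t ρ : ℕ}
    {x : CTrace A n} (hx : IsValue (configAt A e t) ρ x) (hρ : r ≤ ρ) : s ≤ x := by
  refine he.value_induction (fun _ ρ x => r ≤ ρ → s ≤ x) 0 ?_ ?_ ?_ ?_ ?_ (Nat.zero_le t) hx hρ
  · intro ρ x h h'
    have := (isValue_init h).1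
    omega
  · intro _ _ h
    omega
  · exact fun _ _ _ _ h => h
  · exact fun t _ j cmd ρ x _ _ _ h h' => (h h').trans (le_mul_right _ _)
  · intro t _ j r' β c ho h h'
    rcases h'.eq_or_lt with rfl | hlt
    · exact hs _ _ _ _ ho
    · exact he.le_output ho fun k x hk => h k x hk (by omega)

/-- By agreement all outputs of the round extend the stored trace, and later rounds inherit this.
The order of the times `t` and `t'` plays no role. -/
theorem IsInfiniteExecution.S_le_value {e : ℕ → Event n O} (he : IsInfiniteExecution A e)
    {t t' ρ : ℕ} {j : Fin n} {x : CTrace A n} (hx : IsValue (configAt A e t') ρ x)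
    (hρ : ((configAt A e t).S j).1 ≤ ρ) : ((configAt A e t).S j).2 ≤ x := by
  rcases he.S_eq t j with h | ⟨u, -, hu⟩
  · rw [h]
    exact one_le x
  · rcases Nat.eq_zero_or_pos ((configAt A e t).S j).1 with h0 | h0
    · obtain ⟨cmd, s, a, hp, -⟩ := hu
      have hL := he.localInv u j
      simp only [Config.LocalInv, hp] at hL
      omega
    · exact he.le_value h0 (fun t' q β c hq => he.agreement hu hq) hx hρ

theorem IsInfiniteExecution.S_mono {e : ℕ → Event n O} (he : IsInfiniteExecution A e) {t t' : ℕ}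
    (h : t ≤ t') (j : Fin n) : ((configAt A e t).S j).1 ≤ ((configAt A e t').S j).1 ∧
      ((configAt A e t).S j).2 ≤ ((configAt A e t').S j).2 := by
  have h1 : ((configAt A e t).S j).1 ≤ ((configAt A e t').S j).1 := by
    induction t', h using Nat.le_induction with
    | base => exact le_rfl
    | succ t' _ ih =>
      rcases (configAt A e t').S_next (e t') j with h1 | ⟨cmd, r, s, -, hp, h1⟩
      · rw [configAt, h1]
        exact ih
      · have hL := he.localInv t' j
        simp only [Config.LocalInv, hp] at hL
        rw [configAt, h1]
        exact ih.trans hL.2.2.1.le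
  exact ⟨h1, he.S_le_value (Or.inl ⟨j, rfl⟩) h1⟩

theorem Config.pending_nextPhase {C : Config A n} {j : Fin n} {cmd : Command n O}
    (h : C.pending j = some cmd) (hr : ∀ s, (C.loc j).phase ≠ .respond cmd s) :
    (C.nextPhase j).pending = some cmd := by
  rw [Config.pending] at h
  cases hp : (C.loc j).phase <;> simp only [hp, Phase.pending, Option.some.injEq, reduceCtorEq] at h
  all_goals subst h; simp only [Config.nextPhase, hp]
  case scan => split_ifs <;> first | rfl | exact Phase.pending_loop _ _ _ _
  case snapB => exact Phase.pending_loop _ _ _ _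
  case respond s => exact absurd hp (hr s)
  all_goals rfl

theorem IsInfiniteExecution.pending_proc {e : ℕ → Event n O} (he : IsInfiniteExecution A e) {t : ℕ}
    {j : Fin n} {cmd : Command n O} (h : (configAt A e t).pending j = some cmd) : cmd.proc = j := by
  have hL := he.localInv t j
  rw [Config.pending] at h
  cases hp : ((configAt A e t).loc j).phase <;> simp only [hp, Phase.pending, Option.some.injEq, reduceCtorEq] at h
  all_goals subst h; simp only [Config.LocalInv, hp] at hL; exact hL.1

/-- A command that is pending or stored by its process remains so. -/
theorem IsInfiniteExecution.pending_or_stored_succ {e : ℕ → Event n O}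
    (he : IsInfiniteExecution A e) {t : ℕ} {c : Command n O}
    (h : PendingAt A e t c ∨ c ∈ ((configAt A e t).S c.proc).2.ops) :
    PendingAt A e (t + 1) c ∨ c ∈ ((configAt A e (t + 1)).S c.proc).2.ops := by
  have stored : c ∈ ((configAt A e t).S c.proc).2.ops →
      c ∈ ((configAt A e (t + 1)).S c.proc).2.ops := fun h =>
    Multiset.mem_of_le (ops_le (he.S_mono (Nat.le_succ t) c.proc).2) h
  rcases h with h | h
  · rcases he.phase_succ t c.proc with ⟨-, h1⟩ | ⟨-, h1⟩ | ⟨_, cmd, k, -, h1, -⟩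
    · left
      rw [PendingAt, Config.pending, h1]
      exact h
    · by_cases hr : ∃ s, ((configAt A e t).loc c.proc).phase = .respond c s
      · obtain ⟨s, hp⟩ := hr
        have hL := he.localInv t c.proc
        simp only [Config.LocalInv, hp] at hL
        exact Or.inr (stored hL.2.1)
      · left
        rw [PendingAt, Config.pending, h1]
        exact Config.pending_nextPhase h (not_exists.1 hr)
    · rw [PendingAt, Config.pending_eq_none.2 h1] at h
      simp at h
  · exact Or.inr (stored h)

/-- A command enters traces only through a step of its own pending process, and that process
publishes a trace containing it before it responds. -/
theorem IsInfiniteExecution.pending_or_stored {e : ℕ → Event n O} (he : IsInfiniteExecution A e)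
    {t ρ : ℕ} {x : CTrace A n} (hx : IsValue (configAt A e t) ρ x) {c : Command n O}
    (hc : c ∈ x.ops) : PendingAt A e t c ∨ c ∈ ((configAt A e t).S c.proc).2.ops := by
  refine he.value_induction (fun t _ x => ∀ c ∈ x.ops, PendingAt A e t c ∨
    c ∈ ((configAt A e t).S c.proc).2.ops) 0 ?_ ?_ ?_ ?_ ?_ (Nat.zero_le t) hx c hc
  · intro ρ x h c hc
    rw [(isValue_init h).2, ops_one] at hc
    simp at hc
  · intro _ _ c hc
    rw [ops_one] at hc
    simp at hc
  · exact fun t _ ρ x h c hc => he.pending_or_stored_succ (h c hc)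
  · intro t _ j cmd ρ x _ hp _ h c hc
    rcases mem_ops_mul.1 hc with hc | hc
    · exact h c hc
    · obtain rfl : c = cmd := by simpa [ops_mk] using hc
      left
      rw [PendingAt, he.pending_proc hp, hp]
  · intro t _ j r β c ho h o hm
    obtain ⟨k, x, hk, hx⟩ := he.mem_output ho hm
    exact h k x hk o hx

/-! ### Rounds in use -/

/-- The current round of a control state. -/
def Phase.round : Phase A n → ℕ
  | .idle => 0
  | .scan _ _ r _ => r
  | .writeA _ r _ => r
  | .snapA _ r _ => r
  | .writeB _ r _ _ => r
  | .snapB _ r _ _ => r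
  | .publish _ r _ => r
  | .respond _ _ => 0

theorem Phase.round_loop_le (cmd : Command n O) (r : ℕ) (s : CTrace A n) (c : Bool) :
    (Phase.loop cmd r s c).round ≤ r + 1 := by
  rcases Phase.loop_cases cmd r s c with ⟨h, -⟩ | ⟨h, -⟩ | ⟨h, -⟩ <;> rw [h] <;>
    simp [Phase.round]

/-- All rounds used by process `j` are at most `K`. -/
def RoundsLE (C : Config A n) (j : Fin n) (K : ℕ) : Prop :=
  (C.S j).1 ≤ K ∧ (C.loc j).phase.round ≤ K ∧ ∀ r > K, C.snA r j = none

/-- One event moves a process at most one round beyond the rounds in use, so time itself bounds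
them. -/
theorem IsInfiniteExecution.roundsLE {e : ℕ → Event n O} (he : IsInfiniteExecution A e) (t : ℕ)
    (j : Fin n) : RoundsLE (configAt A e t) j t := by
  induction t generalizing j with
  | zero => simp [RoundsLE, configAt, Config.init, Phase.round]
  | succ t ih =>
    obtain ⟨h1, h2, h3⟩ := ih j
    refine ⟨?_, ?_, fun r hr => ?_⟩
    · rcases (configAt A e t).S_next (e t) j with h4 | ⟨cmd, r, s, -, hp, h4⟩
      · rw [configAt, h4]
        omega
      · rw [configAt, h4]
        rw [hp] at h2
        simp only [Phase.round] at h2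
        omega
    · rcases he.phase_succ t j with ⟨-, h4⟩ | ⟨-, h4⟩ | ⟨_, cmd, k, -, -, h4⟩ <;> rw [h4]
      · omega
      · cases hp : ((configAt A e t).loc j).phase <;> rw [hp] at h2 <;>
          simp only [Config.nextPhase, hp, Phase.round] at h2 ⊢
        case scan cmd k ρ s =>
          have hm : ((configAt A e t).scanMax k ρ s).1 ≤ t := by
            rcases (configAt A e t).scanMax_cases k ρ s with h5 | h5 <;> rw [h5]
            · exact (ih k).1
            · exact h2
          by_cases hn : k.val + 1 < n
          · simp only [hn, dite_true]
            omega
          · simp only [hn, dite_false]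
            exact (Phase.round_loop_le _ _ _ _).trans (by omega)
        case snapB => exact (Phase.round_loop_le _ _ _ _).trans (by omega)
        all_goals omega
      · simp [Phase.round]
    · rcases (configAt A e t).snA_next (e t) r j with h4 | ⟨cmd, s, -, hp, -⟩
      · rw [configAt, h4]
        exact h3 r (by omega)
      · rw [hp] at h2
        simp only [Phase.round] at h2
        omega

/-! ### Progress -/

/-- A process that is pending and keeps taking steps eventually takes one from its current control
state. -/
theorem IsInfiniteExecution.exists_next_step {e : ℕ → Event n O} (he : IsInfiniteExecution A e)
    {j : Fin n} (hinf : TakesInfinitelyManySteps e j) {t : ℕ}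
    (hp : ((configAt A e t).loc j).phase ≠ .idle) :
    ∃ u ≥ t, e u = .step j ∧ ((configAt A e u).loc j).phase = ((configAt A e t).loc j).phase ∧
      ((configAt A e (u + 1)).loc j).phase = (configAt A e u).nextPhase j := by
  classical
  have hex := hinf t
  obtain ⟨hu, hs⟩ := Nat.find_spec hex
  refine ⟨Nat.find hex, hu, hs, ?_, ?_⟩
  · have key : ∀ v, t ≤ v → v ≤ Nat.find hex →
        ((configAt A e v).loc j).phase = ((configAt A e t).loc j).phase := by
      intro v hv
      induction v, hv using Nat.le_induction with
      | base => exact fun _ => rfl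
      | succ v hv ih =>
        intro hlt
        have ih := ih (by omega)
        rcases he.phase_succ v j with ⟨-, h1⟩ | ⟨h1, -⟩ | ⟨_, cmd, k, -, h1, -⟩
        · rw [h1, ih]
        · exact absurd ⟨hv, h1⟩ (Nat.find_min hex (by omega))
        · exact absurd (ih ▸ h1) hp
    exact key _ hu le_rfl
  · rw [configAt, hs, Config.phase_next_step]

/-- The steps of process `j` in round `r`, with proposal `s`: the snapshots at the times `u` and
`v`, and the write to the second snapshot object at the time `w`. -/
structure RoundSteps (A : SeqObject Q O R) (e : ℕ → Event n O) (j : Fin n) (cmd : Command n O)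
    (r : ℕ) (s : CTrace A n) (u w v : ℕ) : Prop where
  lt_uw : u < w
  lt_wv : w < v
  snA_eq : (configAt A e u).snA r j = some s
  mem : cmd ∈ s.ops
  snB_eq : (configAt A e (w + 1)).snB r j = some (gcaCandidate ((configAt A e u).snA r))
  phase_eq : ((configAt A e (v + 1)).loc j).phase =
    .loop cmd r (gcaOutput ((configAt A e v).snB r) (gcaCandidate ((configAt A e u).snA r)).1)
      (gcaCommits s ((configAt A e u).snA r) ((configAt A e v).snB r)
        (gcaOutput ((configAt A e v).snB r) (gcaCandidate ((configAt A e u).snA r)).1))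

theorem IsInfiniteExecution.roundSteps {e : ℕ → Event n O} (he : IsInfiniteExecution A e)
    {j : Fin n} (hinf : TakesInfinitelyManySteps e j) {t : ℕ} {cmd : Command n O} {r : ℕ}
    {s : CTrace A n} (hp : ((configAt A e t).loc j).phase = .writeA cmd r s) :
    ∃ u w v, t ≤ v ∧ RoundSteps A e j cmd r s u w v := by
  obtain ⟨t₁, ht₁, -, hp1, hq1⟩ := he.exists_next_step hinf (t := t) (by simp [hp])
  rw [hp] at hp1
  simp only [Config.nextPhase, hp1] at hq1
  obtain ⟨u, hu, -, hp2, hq2⟩ := he.exists_next_step hinf (t := t₁ + 1) (by simp [hq1])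
  rw [hq1] at hp2
  simp only [Config.nextPhase, hp2] at hq2
  obtain ⟨w, hw, -, hp3, hq3⟩ := he.exists_next_step hinf (t := u + 1) (by simp [hq2])
  rw [hq2] at hp3
  simp only [Config.nextPhase, hp3] at hq3
  obtain ⟨v, hv, -, hp4, hq4⟩ := he.exists_next_step hinf (t := w + 1) (by simp [hq3])
  rw [hq3] at hp4
  simp only [Config.nextPhase, hp4] at hq4
  have hLu := he.localInv u j
  simp only [Config.LocalInv, hp2] at hLu
  have hLw := he.localInv (w + 1) j
  simp only [Config.LocalInv, hq3] at hLw
  exact ⟨u, w, v, by omega, by omega, by omega, hLu.2.2.2.2, hLu.2.1, hLw.2.2.2.2.2, hq4⟩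

/-- From `publish`, two own steps lead through `respond` to `idle`. -/
theorem IsInfiniteExecution.phase_of_forever_pending {e : ℕ → Event n O}
    (he : IsInfiniteExecution A e) {j : Fin n} (hinf : TakesInfinitelyManySteps e j) {T : ℕ}
    (hpend : ∀ t ≥ T, (configAt A e t).pending j ≠ none) {t : ℕ} (ht : T ≤ t) :
    ((configAt A e t).loc j).phase ≠ .idle ∧
    (∀ cmd s, ((configAt A e t).loc j).phase ≠ .respond cmd s) ∧
    ∀ cmd r s, ((configAt A e t).loc j).phase ≠ .publish cmd r s := by
  have hidle : ∀ t ≥ T, ((configAt A e t).loc j).phase ≠ .idle := fun t ht h =>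
    hpend t ht (Config.pending_eq_none.2 h)
  have hresp : ∀ t ≥ T, ∀ cmd s, ((configAt A e t).loc j).phase ≠ .respond cmd s := by
    intro t ht cmd s h
    obtain ⟨u, hu, -, hp, hq⟩ := he.exists_next_step hinf (hidle t ht)
    rw [h] at hp
    simp only [Config.nextPhase, hp] at hq
    exact hidle (u + 1) (by omega) hq
  refine ⟨hidle t ht, hresp t ht, fun cmd r s h => ?_⟩
  obtain ⟨u, hu, -, hp, hq⟩ := he.exists_next_step hinf (hidle t ht)
  rw [h] at hp
  simp only [Config.nextPhase, hp] at hq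
  exact hresp (u + 1) (by omega) _ _ hq

theorem Phase.eq_writeA_of_loop {cmd : Command n O} {r : ℕ} {s : CTrace A n} {c : Bool}
    {p : Phase A n} (hp : p = Phase.loop cmd r s c) (hne : ∀ cmd r s, p ≠ .publish cmd r s) :
    ∃ s', p = .writeA cmd (r + 1) s' := by
  rcases Phase.loop_cases cmd r s c with ⟨h, -⟩ | ⟨h, -⟩ | ⟨h, -⟩
  · exact ⟨_, hp.trans h⟩
  · exact ⟨_, hp.trans h⟩
  · exact absurd (hp.trans h) (hne _ _ _)

/-- A process that never completes its operation, but keeps taking steps, goes through all late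
rounds. -/
theorem IsInfiniteExecution.exists_roundSteps {e : ℕ → Event n O} (he : IsInfiniteExecution A e)
    {j : Fin n} (hinf : TakesInfinitelyManySteps e j) {T : ℕ}
    (hpend : ∀ t ≥ T, (configAt A e t).pending j ≠ none) :
    ∃ r₀, ∀ r ≥ r₀, ∃ cmd s u w v, T ≤ v ∧ RoundSteps A e j cmd r s u w v := by
  have hph := fun t (ht : T ≤ t) => he.phase_of_forever_pending hinf hpend ht
  have loop : ∀ t ≥ T, ∀ cmd r s c, ((configAt A e t).loc j).phase = .loop cmd r s c →
      ∃ s', ((configAt A e t).loc j).phase = .writeA cmd (r + 1) s' := fun t ht cmd r s c h =>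
    Phase.eq_writeA_of_loop h (hph t ht).2.2
  have hsnapB : ∀ t ≥ T, ∀ cmd r s a, ((configAt A e t).loc j).phase = .snapB cmd r s a →
      ∃ t' ≥ T, ∃ cmd r s, ((configAt A e t').loc j).phase = .writeA cmd r s := by
    intro t ht cmd r s a h
    obtain ⟨u, hu, -, hp, hq⟩ := he.exists_next_step hinf (hph t ht).1
    rw [h] at hp
    simp only [Config.nextPhase, hp] at hq
    obtain ⟨s', hs'⟩ := loop (u + 1) (by omega) _ _ _ _ hq
    exact ⟨u + 1, by omega, _, _, s', hs'⟩
  have hwriteB : ∀ t ≥ T, ∀ cmd r s a, ((configAt A e t).loc j).phase = .writeB cmd r s a →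
      ∃ t' ≥ T, ∃ cmd r s, ((configAt A e t').loc j).phase = .writeA cmd r s := by
    intro t ht cmd r s a h
    obtain ⟨u, hu, -, hp, hq⟩ := he.exists_next_step hinf (hph t ht).1
    rw [h] at hp
    simp only [Config.nextPhase, hp] at hq
    exact hsnapB (u + 1) (by omega) _ _ _ _ hq
  have hsnapA : ∀ t ≥ T, ∀ cmd r s, ((configAt A e t).loc j).phase = .snapA cmd r s →
      ∃ t' ≥ T, ∃ cmd r s, ((configAt A e t').loc j).phase = .writeA cmd r s := by
    intro t ht cmd r s h
    obtain ⟨u, hu, -, hp, hq⟩ := he.exists_next_step hinf (hph t ht).1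
    rw [h] at hp
    simp only [Config.nextPhase, hp] at hq
    exact hwriteB (u + 1) (by omega) _ _ _ _ hq
  have hscan : ∀ d, ∀ t ≥ T, ∀ cmd k r s, n ≤ k.val + d →
      ((configAt A e t).loc j).phase = .scan cmd k r s →
      ∃ t' ≥ T, ∃ cmd r s, ((configAt A e t').loc j).phase = .writeA cmd r s := by
    intro d
    induction d with
    | zero =>
      intro t _ cmd k r s hk _
      have := k.2
      omega
    | succ d ih =>
      intro t ht cmd k r s hk h
      obtain ⟨u, hu, -, hp, hq⟩ := he.exists_next_step hinf (hph t ht).1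
      rw [h] at hp
      simp only [Config.nextPhase, hp] at hq
      by_cases hn : k.val + 1 < n
      · rw [dif_pos hn] at hq
        exact ih (u + 1) (by omega) _ _ _ _ (by simp only; omega) hq
      · rw [dif_neg hn] at hq
        obtain ⟨s', hs'⟩ := loop (u + 1) (by omega) _ _ _ _ hq
        exact ⟨u + 1, by omega, _, _, s', hs'⟩
  obtain ⟨t₀, ht₀, cmd, r₀, s₀, h₀⟩ :
      ∃ t ≥ T, ∃ cmd r s, ((configAt A e t).loc j).phase = .writeA cmd r s := by
    have hT := hph T le_rfl
    cases hp : ((configAt A e T).loc j).phase with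
    | idle => exact absurd hp hT.1
    | scan cmd k r s => exact hscan n T le_rfl _ _ _ _ (by omega) hp
    | writeA cmd r s => exact ⟨T, le_rfl, _, _, _, hp⟩
    | snapA cmd r s => exact hsnapA T le_rfl _ _ _ hp
    | writeB cmd r s a => exact hwriteB T le_rfl _ _ _ _ hp
    | snapB cmd r s a => exact hsnapB T le_rfl _ _ _ _ hp
    | publish cmd r s => exact absurd hp (hT.2.2 _ _ _)
    | respond cmd s => exact absurd hp (hT.2.1 _ _)
  -- Since the process never publishes, the end of a proposal can only lead to the next round.
  have hwriteA : ∀ r ≥ r₀, ∃ t ≥ T, ∃ cmd s, ((configAt A e t).loc j).phase = .writeA cmd r s := by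
    intro r hr
    induction r, hr using Nat.le_induction with
    | base => exact ⟨t₀, ht₀, cmd, s₀, h₀⟩
    | succ r _ ih =>
      obtain ⟨t, ht, cmd, s, h⟩ := ih
      obtain ⟨u, w, v, hv, hs⟩ := he.roundSteps hinf h
      obtain ⟨s', hs'⟩ := loop (v + 1) (by omega) _ _ _ _ hs.phase_eq
      exact ⟨v + 1, by omega, _, s', hs'⟩
  refine ⟨r₀, fun r hr => ?_⟩
  obtain ⟨t, ht, cmd, s, h⟩ := hwriteA r hr
  obtain ⟨u, w, v, hv, hs⟩ := he.roundSteps hinf h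
  exact ⟨cmd, s, u, w, v, by omega, hs⟩

/-- If from some time on only processes that never complete their operations take events, and the
proposals of all late rounds are pairwise compatible, then there is no such process. -/
theorem IsInfiniteExecution.no_starvation {e : ℕ → Event n O} (he : IsInfiniteExecution A e)
    {P : Finset (Fin n)} {T : ℕ} (hP : P.Nonempty) (hproc : ∀ t ≥ T, (e t).proc ∈ P)
    (hinf : ∀ j ∈ P, TakesInfinitelyManySteps e j)
    (hpend : ∀ j ∈ P, ∀ t ≥ T, (configAt A e t).pending j ≠ none)
    (hcomp : ∃ r₀, ∀ r ≥ r₀, ∀ t k x j y, (configAt A e t).snA r k = some x →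
      (configAt A e t).snA r j = some y → SeqObject.Trace.Comp {y, x}) : False := by
  classical
  obtain ⟨r₀, hcomp⟩ := hcomp
  have hrs : ∀ j : Fin n, ∃ r₁, j ∈ P → ∀ r ≥ r₁, ∃ cmd s u w v, T ≤ v ∧
      RoundSteps A e j cmd r s u w v := by
    intro j
    by_cases hj : j ∈ P
    · obtain ⟨r₁, h⟩ := he.exists_roundSteps (hinf j hj) (hpend j hj)
      exact ⟨r₁, fun _ => h⟩
    · exact ⟨0, fun h => absurd h hj⟩
  choose r₁ hr₁ using hrs
  -- With `T < r`, nothing has been written in round `r` by time `T`, so processes outside `P` never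
  -- propose there.
  obtain ⟨r, hr0, hrT, hr⟩ : ∃ r, r₀ ≤ r ∧ T < r ∧ ∀ j, r₁ j ≤ r :=
    ⟨r₀ + (T + 1) + ∑ j, r₁ j, by omega, by omega, fun j =>
      (Finset.single_le_sum (fun _ _ => Nat.zero_le _) (Finset.mem_univ j)).trans
        (Nat.le_add_left _ _)⟩
  have hdata : ∀ j : P, ∃ cmd s u w v, T ≤ v ∧ RoundSteps A e j cmd r s u w v :=
    fun j => hr₁ j j.2 r (hr j)
  choose cmd s u w v hv hs using hdata
  have hcomp := hcomp r hr0
  -- only the processes of `P` propose in round `r`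
  have hA : ∀ t k x, (configAt A e t).snA r k = some x → ∃ h : k ∈ P, x = s ⟨k, h⟩ := by
    intro t k x hx
    have hk : k ∈ P := by
      by_contra hk
      have hnone : (configAt A e (max t T)).snA r k = none := by
        have : ∀ t' ≥ T, (configAt A e t').snA r k = none := by
          intro t' ht'
          induction t', ht' using Nat.le_induction with
          | base => exact (he.roundsLE T k).2.2 r hrT
          | succ t' ht' ih =>
            rw [configAt, (Config.next_of_proc_ne (j := k) fun h => hk (h ▸ hproc t' ht')).2.2.1, ih]
        exact this _ (le_max_right _ _)
      rw [he.snA_mono (le_max_left t T) hx] at hnone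
      cases hnone
    exact ⟨hk, he.snA_unique hx (hs ⟨k, hk⟩).snA_eq⟩
  have hflag : ∀ t, (gcaCandidate ((configAt A e t).snA r)).2 = true := fun t =>
    gcaCandidate_snd_iff.2 (hcomp t)
  have hB : ∀ t k p, (configAt A e t).snB r k = some p → ∃ h : k ∈ P,
      p = gcaCandidate ((configAt A e (u ⟨k, h⟩)).snA r) := by
    intro t k p hp
    obtain ⟨t', -, -, x, hx⟩ := he.snB_eq_some t hp
    obtain ⟨hk, -⟩ := hA t' k x hx
    exact ⟨hk, he.snB_unique hp (hs ⟨k, hk⟩).snB_eq⟩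
  -- the process with the first snapshot has the least candidate
  obtain ⟨q, -, hq⟩ := Finset.exists_min_image (Finset.univ : Finset P) u
    ⟨⟨hP.choose, hP.choose_spec⟩, Finset.mem_univ _⟩
  obtain ⟨b, hb⟩ : ∃ b, gcaCandidate ((configAt A e (u q)).snA r) = (b, true) :=
    ⟨_, Prod.ext rfl (hflag _)⟩
  have hsq : s q ≤ b := by
    have := (isLUB_gcaCandidate (hflag (u q))).1 ⟨q, (hs q).snA_eq⟩
    rwa [hb] at this
  -- among the processes whose proposals it contains, consider the last one to write its candidate
  obtain ⟨j, hj, hjmax⟩ := Finset.exists_max_image (Finset.univ.filter fun j : P => s j ≤ b) w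
    ⟨q, by simpa using hsq⟩
  simp only [Finset.mem_filter, Finset.mem_univ, true_and] at hj hjmax
  have hseen : ∀ k : P, s k ≤ b → (configAt A e (v j)).snB r k =
      some (gcaCandidate ((configAt A e (u k)).snA r)) := fun k hk => by
    have h1 := hjmax k hk
    have h2 := (hs j).lt_wv
    exact he.snB_mono (by omega) (hs k).snB_eq
  -- The entry of `q` is visible to `j` and is the least of the flagged candidates, so their meet is
  -- `b`.
  have hβ : gcaOutput ((configAt A e (v j)).snB r) (gcaCandidate ((configAt A e (u j)).snA r)).1
      = b := by
    have hqb := hseen q hsq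
    rw [hb] at hqb
    refine SeqObject.Trace.le_antisymm (gcaOutput_le hqb) (le_gcaOutput (fun k x hk => ?_)
      fun hne => absurd ⟨q, b, hqb⟩ hne)
    obtain ⟨hkP, hx⟩ := hB _ _ _ hk
    have h1 := he.gcaCandidate_mono (hq ⟨k, hkP⟩ (Finset.mem_univ _)) (hflag _) (hflag _)
    rw [hb, ← hx] at h1
    exact h1
  have hc : gcaCommits (s j) ((configAt A e (u j)).snA r) ((configAt A e (v j)).snB r) b = true := by
    refine gcaCommits_iff.2 (Or.inr ⟨fun k x hk hx => ?_, ?_⟩)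
    · obtain ⟨hkP, rfl⟩ := hA _ _ _ hk
      rw [hseen ⟨k, hkP⟩ hx]
      simp
    · rintro ⟨k, x, hk⟩
      obtain ⟨hkP, hx⟩ := hB _ _ _ hk
      have := hflag (u ⟨k, hkP⟩)
      rw [← hx] at this
      cases this
  have hmem : cmd j ∈ b.ops := Multiset.mem_of_le (ops_le hj) (hs j).mem
  have hfin := (hs j).phase_eq
  rw [hβ, hc, Phase.loop, if_neg (by simp [hmem])] at hfin
  have hvj := hv j
  exact (he.phase_of_forever_pending (hinf j j.2) (hpend j j.2) (t := v j + 1)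
    (by omega)).2.2 _ _ _ hfin

/-! ### Executions in which nobody completes all operations -/

/-- If no process that keeps taking steps completes all of its operations, then from some time on
all events belong to processes with a forever pending operation. -/
theorem IsInfiniteExecution.eventually_starving {e : ℕ → Event n O} (he : IsInfiniteExecution A e)
    (h : ∀ j, TakesInfinitelyManySteps e j → ¬ CompletesAll A e j) :
    ∃ (P : Finset (Fin n)) (T : ℕ), P.Nonempty ∧ (∀ t ≥ T, (e t).proc ∈ P) ∧
      ∀ j ∈ P, TakesInfinitelyManySteps e j ∧ ∀ t ≥ T, (configAt A e t).pending j ≠ none := by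
  classical
  have key : ∀ j, ∃ T, (TakesInfinitelyManySteps e j →
      ∀ t ≥ T, (configAt A e t).pending j ≠ none) ∧
      (¬ TakesInfinitelyManySteps e j → ∀ t ≥ T, (e t).proc ≠ j) := by
    intro j
    by_cases hj : TakesInfinitelyManySteps e j
    · have hc := h j hj
      unfold CompletesAll at hc
      push Not at hc
      obtain ⟨t, Φ, rfl, -, hΦ⟩ := hc
      refine ⟨t, fun _ t' ht' => ?_, fun h => absurd hj h⟩
      rw [show _ = some Φ from hΦ t' ht']
      simp
    · suffices H : ∃ T, ∀ t ≥ T, (e t).proc ≠ j by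
        obtain ⟨T, hT⟩ := H
        exact ⟨T, fun h => absurd h hj, fun _ => hT⟩
      unfold TakesInfinitelyManySteps at hj
      push Not at hj
      obtain ⟨T₀, hT₀⟩ := hj
      -- A process with finitely many steps can still invoke once after its last step. It is then
      -- pending without stepping, so it has no further event.
      by_cases hinv : ∃ t ≥ T₀, (e t).proc = j
      · obtain ⟨t, ht, hpr⟩ := hinv
        have hpend : ∀ t' ≥ t + 1, ((configAt A e t').loc j).phase ≠ .idle := by
          intro t' ht'
          induction t', ht' using Nat.le_induction with
          | base =>
            rcases he.phase_succ t j with ⟨h1, -⟩ | ⟨h1, -⟩ | ⟨_, _, _, -, -, h1⟩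
            · exact absurd hpr h1
            · exact absurd h1 (hT₀ t ht)
            · simp [h1]
          | succ t' ht' ih =>
            rcases he.phase_succ t' j with ⟨-, h1⟩ | ⟨h1, -⟩ | ⟨_, _, _, -, -, h1⟩
            · rwa [h1]
            · exact absurd h1 (hT₀ t' (by omega))
            · simp [h1]
        refine ⟨t + 1, fun t' ht' hpr' => ?_⟩
        rcases he.phase_succ t' j with ⟨h1, -⟩ | ⟨h1, -⟩ | ⟨_, _, _, -, h1, -⟩
        · exact h1 hpr'
        · exact hT₀ t' (by omega) h1
        · exact hpend t' ht' h1
      · push Not at hinv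
        exact ⟨T₀, hinv⟩
  choose T hT hT' using key
  have hle : ∀ j, T j ≤ ∑ j, T j := fun j =>
    Finset.single_le_sum (fun _ _ => Nat.zero_le _) (Finset.mem_univ j)
  have hmem : ∀ t ≥ ∑ j, T j, (e t).proc ∈
      Finset.univ.filter fun j => TakesInfinitelyManySteps e j := by
    intro t ht
    rw [Finset.mem_filter]
    refine ⟨Finset.mem_univ _, ?_⟩
    by_contra hn
    exact hT' _ hn t ((hle _).trans ht) rfl
  refine ⟨_, ∑ j, T j, ⟨_, hmem _ le_rfl⟩, hmem, fun j hj => ?_⟩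
  rw [Finset.mem_filter] at hj
  exact ⟨hj.2, fun t ht => hT j hj.2 t ((hle j).trans ht)⟩

theorem RoundsLE.of_proc_ne {e : ℕ → Event n O} {m K : ℕ} {j : Fin n}
    (h : RoundsLE (configAt A e m) j K) (hne : ∀ t ≥ m, (e t).proc ≠ j) {t : ℕ} (ht : m ≤ t) :
    RoundsLE (configAt A e t) j K := by
  induction t, ht using Nat.le_induction with
  | base => exact h
  | succ t ht ih =>
    obtain ⟨h1, h2, h3, -⟩ := Config.next_of_proc_ne (C := configAt A e t) (hne t ht)
    simpa only [RoundsLE, configAt, h1, h2, h3] using ih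

/-! ### The conflict-forgetting configurations -/

/-- When an idle process `i` has stored its trace with a round `r` that no other process has
reached, all later outputs of round `r` are equal to that trace. -/
theorem IsInfiniteExecution.output_eq {e : ℕ → Event n O} (he : IsInfiniteExecution A e) {m K : ℕ}
    {i : Fin n} (hK : K < ((configAt A e m).S i).1)
    (hothers : ∀ j ≠ i, RoundsLE (configAt A e m) j K) {t : ℕ} (ht : m ≤ t) {j : Fin n}
    {β : CTrace A n} {c : Bool} (ho : IsOutput A e t j ((configAt A e m).S i).1 β c) :
    β = ((configAt A e m).S i).2 := by
  rcases he.S_eq m i with h | ⟨u, hu, hout⟩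
  · rw [h] at hK
    simp at hK
  · refine SeqObject.Trace.le_antisymm ?_ (he.agreement hout ho)
    obtain ⟨u', hu', s, hs, hB, hβ, -⟩ := he.output_data hout
    -- Up to time `m` only `i` has written in this round, so its candidate is its own proposal with
    -- flag `true`.
    have hA : ∀ v ≤ m, ∀ k x, (configAt A e v).snA ((configAt A e m).S i).1 k = some x →
        x = s := by
      intro v hv k x hx
      obtain rfl : k = i := by
        by_contra hk
        have h1 := he.snA_mono hv hx
        rw [(hothers k hk).2.2 _ hK] at h1
        cases h1
      exact he.snA_unique hx hs
    rw [gcaCandidate_of_forall_eq ⟨i, hs⟩ (hA u' (by omega))] at hB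
    have hle : s ≤ ((configAt A e m).S i).2 := by
      rw [hβ]
      refine le_gcaOutput (fun k x hk => ?_) fun hne => absurd ⟨i, s, hB⟩ hne
      obtain ⟨w, hw, hx, y, hy⟩ := he.snB_eq_some u hk
      rw [gcaCandidate_of_forall_eq ⟨k, hA w (by omega) k y hy ▸ hy⟩ (hA w (by omega))] at hx
      exact (Prod.ext_iff.1 hx).1.ge
    refine le_trans ?_ hle
    -- The entry of `i` in `B` is permanent and flagged, so it takes part in every later meet of
    -- this round.
    obtain ⟨_, -, _, -, -, rfl, -⟩ := he.output_data ho
    exact gcaOutput_le (he.snB_mono (hu.le.trans ht) hB)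

/-- In that situation, commands of later traces are in the stored trace or take a step later. -/
theorem IsInfiniteExecution.mem_or_takesStepFrom {e : ℕ → Event n O}
    (he : IsInfiniteExecution A e) {m K : ℕ} {i : Fin n}
    (hidle : (configAt A e m).pending i = none) (hK : K < ((configAt A e m).S i).1)
    (hothers : ∀ j ≠ i, RoundsLE (configAt A e m) j K) {t ρ : ℕ} (ht : m ≤ t) {x : CTrace A n}
    (hx : IsValue (configAt A e t) ρ x) (hρ : ((configAt A e m).S i).1 ≤ ρ) {c : Command n O}
    (hc : c ∈ x.ops) : c ∈ ((configAt A e m).S i).2.ops ∨ TakesStepFrom A e m c := by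
  refine he.value_induction (fun _ ρ x => ((configAt A e m).S i).1 ≤ ρ → ∀ c ∈ x.ops,
    c ∈ ((configAt A e m).S i).2.ops ∨ TakesStepFrom A e m c) m ?_ ?_ ?_ ?_ ?_ ht hx hρ c hc
  · intro ρ x hx hρ c hc
    have hphase : ((configAt A e m).loc i).phase = .idle := Config.pending_eq_none.1 hidle
    -- At time `m` no control state has a round above `K`, so the only value of round at least that
    -- of `i` is the register of `i`.
    have hne : ∀ j, ((configAt A e m).loc j).phase.round ≤ K := by
      intro j
      by_cases hj : j = i
      · rw [hj, hphase]
        exact Nat.zero_le _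
      · exact (hothers j hj).2.1
    rcases hx with ⟨j, h⟩ | ⟨j, cmd, k, h⟩ | ⟨j, cmd, h⟩ | ⟨j, cmd, h⟩ | ⟨k, h⟩
    · by_cases hj : j = i
      · rw [hj] at h
        rw [h]
        exact Or.inl hc
      · have := (hothers j hj).1
        rw [h] at this
        simp only at this
        omega
    · have := hne j
      rw [h] at this
      simp only [Phase.round] at this
      omega
    · have := hne j
      rw [h] at this
      simp only [Phase.round] at this
      omega
    · have := hne j
      rw [h] at this
      simp only [Phase.round] at this
      omega
    · by_cases hk : k = i
      · have hL := he.localInv m i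
        simp only [Config.LocalInv, hphase] at hL
        rw [hk, hL.1 _ (by omega)] at h
        cases h
      · rw [(hothers k hk).2.2 _ (by omega)] at h
        cases h
  · intro _ _ h
    omega
  · exact fun _ _ _ _ h => h
  · intro t ht j cmd ρ x het hp _ h hρ c hc
    rcases mem_ops_mul.1 hc with hc | hc
    · exact h hρ c hc
    · obtain rfl : c = cmd := by simpa [ops_mk] using hc
      have hj := he.pending_proc hp
      exact Or.inr ⟨t, ht, by rw [hj, het], by rw [PendingAt, hj, hp]⟩
  · intro t ht j r β c ho h hr o hm
    rcases hr.eq_or_lt with heq | hlt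
    · rw [← heq] at ho
      rw [he.output_eq hK hothers ht ho] at hm
      exact Or.inl hm
    · obtain ⟨k, x, hk, hx⟩ := he.mem_output ho hm
      exact h k x hk (by omega) o hx

/-- If everyone starved, late proposals would differ from a common stored prefix only by pending
commands that take a step after time `m`. These do not conflict, so the proposals are compatible and
`no_starvation` applies. -/
theorem IsInfiniteExecution.exists_completesAll {e : ℕ → Event n O}
    (he : IsInfiniteExecution A e) {m K : ℕ} {i : Fin n}
    (hidle : (configAt A e m).pending i = none) (hK : K < ((configAt A e m).S i).1)
    (hothers : ∀ j ≠ i, RoundsLE (configAt A e m) j K)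
    (hcf : EventuallyWeaklyConflictFree A e m) :
    ∃ j, TakesInfinitelyManySteps e j ∧ CompletesAll A e j := by
  classical
  by_contra hno
  push Not at hno
  obtain ⟨P, T₀, hP, hproc, hPj⟩ := he.eventually_starving hno
  obtain ⟨T₁, hT₁⟩ := hcf
  obtain ⟨T, hT0, hT1, hTm⟩ : ∃ T, T₀ ≤ T ∧ T₁ ≤ T ∧ m ≤ T :=
    ⟨T₀ + T₁ + m, by omega, by omega, by omega⟩
  have hproc' : ∀ t ≥ T, (e t).proc ∈ P := fun t ht => hproc t (hT0.trans ht)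
  have hpend : ∀ j ∈ P, ∀ t ≥ T, (configAt A e t).pending j ≠ none := fun j hj t ht =>
    (hPj j hj).2 t (hT0.trans ht)
  -- Rounds beyond `T` are entered only after time `T`. With this bound, the preceding round `ρ` is
  -- also at least the round of every register at time `T` and that of `i` at time `m`.
  refine he.no_starvation hP hproc' (fun j hj => (hPj j hj).1) hpend
    ⟨T + 1 + ((configAt A e m).S i).1, fun r hr t k x j y hx hy => ?_⟩
  -- the registers do not change any more
  have hS : ∀ t ≥ T, ∀ j, (configAt A e t).S j = (configAt A e T).S j := by
    intro t ht j
    induction t, ht using Nat.le_induction with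
    | base => rfl
    | succ t ht ih =>
      rcases (configAt A e t).S_next (e t) j with h1 | ⟨cmd, r, s, het, hp, -⟩
      · rw [configAt, h1, ih]
      · have hj : j ∈ P := by
          have := hproc' t ht
          rwa [het] at this
        exact absurd hp ((he.phase_of_forever_pending (hPj j hj).1 (hpend j hj) ht).2.2 _ _ _)
  obtain ⟨j₀, -, hj₀⟩ := Finset.exists_max_image (Finset.univ : Finset (Fin n))
    (fun j => ((configAt A e T).S j).1) ⟨i, Finset.mem_univ _⟩
  set s₀ := ((configAt A e T).S j₀).2 with hs₀
  have hSle : ∀ j, ((configAt A e T).S j).2 ≤ s₀ := fun j =>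
    he.S_le_value (t' := T) (Or.inl ⟨j₀, rfl⟩) (hj₀ j (Finset.mem_univ j))
  have hTt : T ≤ t := by
    by_contra hlt
    rw [(he.roundsLE t k).2.2 r (by omega)] at hx
    cases hx
  obtain ⟨ρ, rfl⟩ : ∃ ρ, r = ρ + 1 := ⟨r - 1, by omega⟩
  -- every proposal consists of `s₀` and pending commands
  have hform : ∀ k x, (configAt A e t).snA (ρ + 1) k = some x → ∃ z, x = s₀ * z ∧
      ∀ c ∈ z.ops, PendingAt A e t c ∧ TakesStepFrom A e m c := by
    intro k x hx
    have hval : IsValue (configAt A e t) ρ x := Or.inr (Or.inr (Or.inr (Or.inr ⟨k, hx⟩)))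
    have hround := (he.roundsLE T j₀).1
    obtain ⟨z, rfl⟩ : s₀ ≤ x := he.S_le_value hval (by omega)
    refine ⟨z, rfl, fun c hc => ?_⟩
    have hnd := he.nodup hval
    rw [ops_mul] at hnd
    have hc₀ : c ∉ s₀.ops := fun h => Multiset.disjoint_left.1 (Multiset.nodup_add.1 hnd).2.2 h hc
    have hcx : c ∈ (s₀ * z).ops := mem_ops_mul.2 (Or.inr hc)
    constructor
    · rcases he.pending_or_stored hval hcx with h | h
      · exact h
      · rw [hS t hTt] at h
        exact absurd (Multiset.mem_of_le (ops_le (hSle _)) h) hc₀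
    · rcases he.mem_or_takesStepFrom hidle hK hothers (hTm.trans hTt) hval (by omega) hcx with h | h
      · exact absurd (Multiset.mem_of_le (ops_le ((he.S_mono hTm i).2.trans (hSle i))) h) hc₀
      · exact h
  obtain ⟨z, rfl, hz⟩ := hform k x hx
  obtain ⟨z', rfl, hz'⟩ := hform j y hy
  -- A command common to both residuals commutes with itself; distinct ones are concurrent at time
  -- `t` and fall under the conflict-freedom hypothesis.
  have hcomm : z * z' = z' * z := mul_comm_of_forall fun c hc c' hc' => by
    by_cases hne : c = c'
    · exact Or.inl hne
    · exact Or.inr (hT₁ t (hT1.trans hTt) c c' hne (hz c hc).1 (hz' c' hc').1 (hz c hc).2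
        (hz' c' hc').2)
  exact comp_pair.2 ⟨s₀ * (z * z'), hcomm ▸ mul_le_mul_left' _ (le_mul_right _ _),
    mul_le_mul_left' _ (le_mul_right _ _)⟩

/-! ### Solo extensions -/

theorem Config.executes_iff {C : Config A n} {l : List (Event n O)} :
    C.Executes l ↔ ∀ (k : ℕ) (h : k < l.length), ((l.take k).foldl Config.next C).Enabled l[k] := by
  induction l generalizing C with
  | nil => simp [Config.Executes]
  | cons ev l ih =>
    rw [Config.Executes, ih]
    constructor
    · rintro ⟨h1, h2⟩ k hk
      cases k with
      | zero => exact h1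
      | succ k => exact h2 k (by simpa using hk)
    · intro h
      exact ⟨h 0 (by simp), fun k hk => h (k + 1) (by simpa using hk)⟩

theorem configAt_eq_foldl {e : ℕ → Event n O} {l : List (Event n O)} (h : Extends e l) {t : ℕ}
    (ht : t ≤ l.length) : configAt A e t = (l.take t).foldl Config.next (Config.init A n) := by
  induction t with
  | zero => rfl
  | succ t ih =>
    rw [configAt, ih (by omega), h t ht, List.take_add_one, List.foldl_append,
      List.getElem?_eq_getElem ht]
    rfl

theorem IsInfiniteExecution.isFiniteExecution {e : ℕ → Event n O} (he : IsInfiniteExecution A e)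
    {l : List (Event n O)} (h : Extends e l) : IsFiniteExecution A l := by
  refine Config.executes_iff.2 fun k hk => ?_
  rw [← configAt_eq_foldl h hk.le, ← h k hk]
  exact he k

open Classical in
/-- The next event of a solo run of process `i`, which invokes `o` whenever it is idle. -/
noncomputable def soloEvent (o : O) (i : Fin n) (C : Config A n) : Event n O :=
  if C.pending i = none then .invoke i o else .step i

theorem soloEvent_proc (o : O) (i : Fin n) (C : Config A n) : (soloEvent o i C).proc = i := by
  unfold soloEvent
  split_ifs <;> rfl

theorem enabled_soloEvent (o : O) (i : Fin n) (C : Config A n) : C.Enabled (soloEvent o i C) := by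
  unfold soloEvent
  split_ifs with h
  · exact h
  · exact h

theorem exists_solo_execution {α : List (Event n O)} (hα : IsFiniteExecution A α) (o : O)
    (i : Fin n) : ∃ e : ℕ → Event n O, IsInfiniteExecution A e ∧ Extends e α ∧
      ∀ t ≥ α.length, (e t).proc = i := by
  let D : ℕ → Config A n := fun t =>
    Nat.rec (α.foldl Config.next (Config.init A n)) (fun _ C => C.next (soloEvent o i C)) t
  let e : ℕ → Event n O := fun t =>
    if h : t < α.length then α[t] else soloEvent o i (D (t - α.length))
  have hext : Extends e α := fun k hk => dif_pos hk
  have hsolo : ∀ t, e (α.length + t) = soloEvent o i (D t) := fun t => by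
    simp only [e]
    rw [dif_neg (by omega), Nat.add_sub_cancel_left]
  have hD : ∀ t, configAt A e (α.length + t) = D t := by
    intro t
    induction t with
    | zero =>
      rw [Nat.add_zero, configAt_eq_foldl hext le_rfl, List.take_length]
      rfl
    | succ t ih => rw [← Nat.add_assoc, configAt, ih, hsolo]
  refine ⟨e, fun t => ?_, hext, fun t ht => ?_⟩
  · by_cases h : t < α.length
    · rw [configAt_eq_foldl hext h.le, hext t h]
      exact Config.executes_iff.1 hα t h
    · obtain ⟨t, rfl⟩ := Nat.exists_eq_add_of_le (not_lt.1 h)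
      rw [hD, hsolo]
      exact enabled_soloEvent _ _ _
  · obtain ⟨t, rfl⟩ := Nat.exists_eq_add_of_le ht
    rw [hsolo, soloEvent_proc]

/-- A late round of a solo run has a single proposal, which is trivially compatible with itself, so
`no_starvation` applies to the one process `i`. -/
theorem IsInfiniteExecution.solo_completes {e : ℕ → Event n O} (he : IsInfiniteExecution A e)
    {m : ℕ} {i : Fin n} (hsolo : ∀ t ≥ m, (e t).proc = i) (t : ℕ) :
    ∃ t' ≥ t, (configAt A e t').pending i = none := by
  by_contra hno
  push Not at hno
  have hother : ∀ j ≠ i, ¬ TakesInfinitelyManySteps e j := by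
    intro j hj h
    obtain ⟨t', ht', h1⟩ := h m
    have := hsolo t' ht'
    rw [h1] at this
    exact hj this
  have hinf : TakesInfinitelyManySteps e i := by
    intro T
    refine ⟨T + m + t, by omega, ?_⟩
    have h1 := hsolo (T + m + t) (by omega)
    have h2 := he (T + m + t)
    cases h3 : e (T + m + t) with
    | step j => rw [h3] at h1; rw [← h1]; rfl
    | invoke j o =>
      rw [h3] at h1 h2
      obtain rfl : j = i := h1
      exact absurd h2 (hno _ (by omega))
  refine he.no_starvation (P := {i}) (T := m + t) ⟨i, by simp⟩ (fun t' ht' => ?_) ?_ ?_ ?_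
  · simpa using hsolo t' (by omega)
  · intro j hj
    obtain rfl : j = i := by simpa using hj
    exact hinf
  · intro j hj t' ht'
    obtain rfl : j = i := by simpa using hj
    exact hno t' (by omega)
  · refine ⟨m + 1, fun r hr t' k x j y hx hy => ?_⟩
    have honly : ∀ k x, (configAt A e t').snA r k = some x → k = i := by
      intro k x hx
      by_contra hk
      have h1 := (he.roundsLE m k).of_proc_ne
        (fun t ht h => hk (h.symm.trans (hsolo t ht))) (le_max_right t' m)
      have h2 := he.snA_mono (le_max_left t' m) hx
      rw [h1.2.2 r (by omega)] at h2
      cases h2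
    obtain rfl := honly k x hx
    obtain rfl := honly j y hy
    rw [hx] at hy
    cases hy
    exact comp_pair.2 ⟨x, le_rfl, le_rfl⟩

/-- Between two times at which a process is idle, the round of its register increases if it takes
an event at the first one. -/
theorem IsInfiniteExecution.S_lt_of_idle {e : ℕ → Event n O} (he : IsInfiniteExecution A e)
    {i : Fin n} {t t' : ℕ} (h : (configAt A e t).pending i = none) (hi : (e t).proc = i)
    (htt : t < t') (h' : (configAt A e t').pending i = none) :
    ((configAt A e t).S i).1 < ((configAt A e t').S i).1 := by
  have key : ∀ v ≥ t + 1, ((configAt A e t).S i).1 < ((configAt A e v).S i).1 ∨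
      (((configAt A e v).loc i).phase ≠ .idle ∧
        ∀ cmd s, ((configAt A e v).loc i).phase ≠ .respond cmd s) := by
    intro v hv
    induction v, hv using Nat.le_induction with
    | base =>
      right
      rcases he.phase_succ t i with ⟨h1, -⟩ | ⟨h1, -⟩ | ⟨_, _, _, -, -, h1⟩
      · exact absurd hi h1
      · have := he t
        rw [h1] at this
        exact absurd h this
      · simp [h1]
    | succ v hv ih =>
      rcases ih with ih | ⟨ih1, ih2⟩
      · exact Or.inl (ih.trans_le (he.S_mono (Nat.le_succ v) i).1)
      · rcases he.phase_succ v i with ⟨-, h1⟩ | ⟨h0, h1⟩ | ⟨_, _, _, -, h1, -⟩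
        · rw [h1]
          exact Or.inr ⟨ih1, ih2⟩
        · have loop : ∀ cmd r s c,
              ((configAt A e (v + 1)).loc i).phase = Phase.loop cmd r s c →
              (((configAt A e (v + 1)).loc i).phase ≠ .idle ∧
                ∀ cmd s, ((configAt A e (v + 1)).loc i).phase ≠ .respond cmd s) := by
            intro cmd r s c hl
            rcases Phase.loop_cases cmd r s c with ⟨h2, -⟩ | ⟨h2, -⟩ | ⟨h2, -⟩ <;>
              simp [hl, h2]
          cases hp : ((configAt A e v).loc i).phase <;> simp only [Config.nextPhase, hp] at h1
          case idle => exact absurd hp ih1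
          case respond => exact absurd hp (ih2 _ _)
          case scan =>
            split_ifs at h1
            · simp [h1]
            · exact Or.inr (loop _ _ _ _ h1)
          case snapB => exact Or.inr (loop _ _ _ _ h1)
          case publish cmd r s =>
            left
            have hL := he.localInv v i
            simp only [Config.LocalInv, hp] at hL
            have hS : (configAt A e (v + 1)).S i = (r, s) := by
              rw [configAt, h0]
              simp [Config.next, hp, Config.setPhase]
            rw [hS]
            exact (he.S_mono (by omega : t ≤ v) i).1.trans_lt hL.2.2.1
          all_goals simp [h1]
        · exact absurd h1 ih1
  rcases key t' htt with h1 | ⟨h1, -⟩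
  · exact h1
  · exact absurd (Config.pending_eq_none.1 h') h1

theorem IsInfiniteExecution.exists_idle_of_solo {e : ℕ → Event n O} (he : IsInfiniteExecution A e)
    {m : ℕ} {i : Fin n} (hsolo : ∀ t ≥ m, (e t).proc = i) (N : ℕ) :
    ∃ t ≥ m, (configAt A e t).pending i = none ∧ N ≤ ((configAt A e t).S i).1 := by
  induction N with
  | zero =>
    obtain ⟨t, ht, h⟩ := he.solo_completes hsolo m
    exact ⟨t, ht, h, Nat.zero_le _⟩
  | succ N ih =>
    obtain ⟨t, ht, h, hN⟩ := ih
    obtain ⟨t', ht', h'⟩ := he.solo_completes hsolo (t + 1)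
    exact ⟨t', by omega, h', hN.trans_lt (he.S_lt_of_idle h (hsolo t ht) ht' h')⟩

end Executions

end ConflictFree

/-- Every finite execution of the weakly conflict-free universal construction has, for every
process `i`, a finite `i`-solo extension that is conflict-forgetting. -/
theorem mainTheorem7 {Q O R : Type*} (A : ConflictFree.SeqObject Q O R) (n : ℕ)
    (α : List (ConflictFree.Event n O)) (hα : ConflictFree.IsFiniteExecution A α) (i : Fin n) :
    ∃ β : List (ConflictFree.Event n O), (∀ ev ∈ β, ev.proc = i) ∧
      ConflictFree.IsFiniteExecution A (α ++ β) ∧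
      ConflictFree.ConflictForgetting A (α ++ β) := by
  open ConflictFree in
  rcases isEmpty_or_nonempty O with hO | ⟨⟨o⟩⟩
  -- Without operations no first event is enabled, so there is no infinite execution at all.
  · refine ⟨[], by simp, by simpa using hα, fun e he _ _ => ?_⟩
    have h0 := he 0
    cases h : e 0 with
    | invoke j o => exact isEmptyElim o
    | step j =>
      rw [h] at h0
      exact absurd rfl h0
  · obtain ⟨e, he, hext, hsolo⟩ := exists_solo_execution hα o i
    -- All rounds in use after `α` are at most its length, and the other processes stay there during
    -- the solo run; one more makes the round of `i` exclusive.
    obtain ⟨m, hm, hidle, hK⟩ := he.exists_idle_of_solo hsolo (α.length + 1)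
    let β := (List.range (m - α.length)).map fun t => e (α.length + t)
    have hlen : (α ++ β).length = m := by simp [β]; omega
    have hget : ∀ k (h : k < (α ++ β).length), (α ++ β)[k] = e k := by
      intro k h
      by_cases hk : k < α.length
      · rw [List.getElem_append_left hk, hext k hk]
      · rw [List.getElem_append_right (not_lt.1 hk)]
        simp only [β, List.getElem_map, List.getElem_range]
        congr 1
        omega
    refine ⟨β, fun ev hev => ?_, he.isFiniteExecution fun k h => (hget k h).symm,
      fun e' he' hext' hcf => ?_⟩
    · obtain ⟨t, -, rfl⟩ := List.mem_map.1 hev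
      exact hsolo _ (by omega)
    -- Both executions begin with `α ++ β`, so the configuration at time `m` found in the solo run
    -- is also that of `e'`.
    · have hconf : configAt A e' m = configAt A e m := by
        rw [configAt_eq_foldl hext' hlen.ge,
          configAt_eq_foldl (l := α ++ β) (fun k h => (hget k h).symm) hlen.ge]
      have hothers : ∀ j ≠ i, RoundsLE (configAt A e m) j α.length := fun j hj =>
        (he.roundsLE α.length j).of_proc_ne (fun t ht h => hj (h.symm.trans (hsolo t ht))) hm
      rw [hlen] at hcf
      obtain ⟨j, hj1, hj2⟩ := he'.exists_completesAll (m := m) (K := α.length) (i := i)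
        (by rw [hconf]; exact hidle) (by rw [hconf]; exact hK) (by rw [hconf]; exact hothers) hcf
      exact ⟨j, Or.inl hj1, hj1, hj2⟩
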